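/- **Definitions.** Let $A\in\mathbb R^{n\times n}$; vector inequalities are componentwise. For $q\in\mathbb R^n$ let $\mathrm{FEA}(q,A)=\{z\ge 0: q+Az\ge 0\}$ and $\mathrm{SOL}(q,A)=\{z\in \mathrm{FEA}(q,A): z^T(q+Az)=0\}$, the feasible and the solution set of the linear complementarity problem LCP$(q,A)$: $w-Az=q$, $w\ge0$, $z\ge0$, $w^Tz=0$. * $A\in P_0$ if all principal minors of $A$ are nonnegative. $A\in E_0$ (semimonotone) if for every $0\ne x\ge 0$ there is an $i$ with $x_i>0$ and $(Ax)_i\ge 0$. $A\in E_0^s$ if $A\in E_0$ and $x\ge 0$, $Ax\ge 0$, $x^TAx=0$ imply $A^Tx\le 0$. $A\in\tilde E_0^s$ if $A\in E_0^s$ and for every $x\in\mathrm{SOL}(0,A)$ and every $i$, $(A^Tx)_i\neq 0$ implies $(Ax)_i\ne 0$. * $A$ is *copositive* ($C_0$) if $x^TAx\ge 0$ for all $x\ge 0$. $A$ is *exact order $k$ $C_0$* if it is copositive up to order $n-k$, i.e. every principal submatrix of $A$ of order at most $n-k$ is copositive. * For $\alpha\subseteq\{1,\dots,n\}$ with $\det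 A_{\alpha\alpha}\ne0$ (where $\det A_{\emptyset\emptyset}=1$), the *principal pivot transform* (PPT) of $A$ with respect to $\alpha$ is the matrix $M$ with $M_{\alpha\alpha}=A_{\alpha\alpha}^{-1}$, $M_{\alpha\bar\alpha}=-A_{\alpha\alpha}^{-1}A_{\alpha\bar\alpha}$, $M_{\bar\alpha\alpha}=A_{\bar\alpha\alpha}A_{\alpha\alpha}^{-1}$, $M_{\bar\alpha\bar\alpha}=A_{\bar\alpha\bar\alpha}-A_{\bar\alpha\alpha}A_{\alpha\alpha}^{-1}A_{\alpha\bar\alpha}$; for $\alpha=\emptyset$ it is $A$ itself. * $A$ is *exact order $k$ $C_0^f$* if each of its PPTs is exact order $k$ $C_0$ or $E_0$, and at least one PPT of $A$ is exact order $k$ $C_0$. * *Lemke's algorithm* for LCP$(q,A)$ with covering vector $d>0$ works on $w-Az-z_0d=q$, $(w,z,z_0)\ge0$. If $q\ge 0$ it stops with $z=0$. Otherwise $z_0$ enters the basis $(w_1,\dots,w_n)$ in place of the $w_r$ with least $q_r/d_r$, and $z_r$ enters next. At each further step the entering variable is increased; if it can increase without bound, the algorithm stops on a ray; otherwise the leaving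 variable is found by the minimum ratio test. If $z_0$ attains the minimum ratio, it leaves and the algorithm stops with the resulting $z$; otherwise the complement ($w_i\leftrightarrow z_i$) of the leaving variable enters next. All other ties (those of the first step included) are broken lexicographically, by comparing the rows of $[\,B^{-1}q\mid B^{-1}]$, divided by the respective entries of the updated entering column ($d_i$ in the first step), where $B$ is the current basis matrix. LCP$(q,A)$ is *processable by Lemke's algorithm* if for every $d>0$ the algorithm stops after finitely many steps, either with some $z\in\mathrm{SOL}(q,A)$, or on a ray, in which case $\mathrm{FEA}(q,A)=\emptyset$. **Theorem.** Let $n\ge k+2$, $k\ge 0$, and let $A\in\mathbb R^{n\times n}$ be an $\tilde E_0^s$-matrix that is exact order $k$ $C_0^f$. Suppose that each PPT of $A$ is either exact order $k$ $C_0$, or $E_0$ with at least $k$ positive diagonal entries. Then $A\in P_0$, and for every $q\in\mathbb R^n$, LCP$(q,A)$ is processable by Lemke's algorithm. -/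

import Mathlib

open scoped Matrix

/-! Linear complementarity problems, matrix classes, principal pivot transforms and
Lemke's algorithm. Vectors are compared componentwise. -/

namespace LCP

/-- The feasible set of the problem `w - A z = q`, `w ≥ 0`, `z ≥ 0`, in terms of `z`. -/
def FEA {n : ℕ} (q : Fin n → ℝ) (A : Matrix (Fin n) (Fin n) ℝ) : Set (Fin n → ℝ) :=
  {z | 0 ≤ z ∧ 0 ≤ q + A *ᵥ z}

/-- The solution set: feasible points with `zᵀ (q + A z) = 0`. -/
def SOL {n : ℕ} (q : Fin n → ℝ) (A : Matrix (Fin n) (Fin n) ℝ) : Set (Fin n → ℝ) :=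
  {z | z ∈ FEA q A ∧ z ⬝ᵥ (q + A *ᵥ z) = 0}

/-- The principal submatrix with rows and columns in `α`. -/
def principalSubmatrix {n : ℕ} (A : Matrix (Fin n) (Fin n) ℝ) (α : Finset (Fin n)) :
    Matrix {i // i ∈ α} {i // i ∈ α} ℝ :=
  A.toBlock (fun i => i ∈ α) (fun i => i ∈ α)

/-- `P₀`: all principal minors are nonnegative. -/
def IsP0 {n : ℕ} (A : Matrix (Fin n) (Fin n) ℝ) : Prop :=
  ∀ α : Finset (Fin n), 0 ≤ (principalSubmatrix A α).det

/-- `E₀` (semimonotone). -/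
def IsE0 {n : ℕ} (A : Matrix (Fin n) (Fin n) ℝ) : Prop :=
  ∀ x : Fin n → ℝ, 0 ≤ x → x ≠ 0 → ∃ i, 0 < x i ∧ 0 ≤ (A *ᵥ x) i

/-- `E₀ˢ` (semimonotone star). -/
def IsE0s {n : ℕ} (A : Matrix (Fin n) (Fin n) ℝ) : Prop :=
  IsE0 A ∧ ∀ x : Fin n → ℝ, x ⬝ᵥ (A *ᵥ x) = 0 → 0 ≤ A *ᵥ x → 0 ≤ x → Aᵀ *ᵥ x ≤ 0

/-- `Ẽ₀ˢ`. -/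
def IsE0sTilde {n : ℕ} (A : Matrix (Fin n) (Fin n) ℝ) : Prop :=
  IsE0s A ∧ ∀ x ∈ SOL 0 A, ∀ i, (Aᵀ *ᵥ x) i ≠ 0 → (A *ᵥ x) i ≠ 0

/-- `C₀` (copositive), over an arbitrary finite index type. -/
def IsCopositive {ι : Type*} [Fintype ι] (A : Matrix ι ι ℝ) : Prop :=
  ∀ x : ι → ℝ, 0 ≤ x → 0 ≤ x ⬝ᵥ (A *ᵥ x)

/-- Copositive of exact order `k`: copositive up to order `n - k`, that is, every principal
submatrix of order at most `n - k` is copositive. -/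
def IsExactOrderC0 {n : ℕ} (k : ℕ) (A : Matrix (Fin n) (Fin n) ℝ) : Prop :=
  ∀ α : Finset (Fin n), α.card + k ≤ n → IsCopositive (principalSubmatrix A α)

/-- The principal pivot transform of `A` with respect to `α`; it is meaningful when the
principal submatrix on `α` is nonsingular. -/
noncomputable def ppt {n : ℕ} (A : Matrix (Fin n) (Fin n) ℝ) (α : Finset (Fin n)) :
    Matrix (Fin n) (Fin n) ℝ :=
  let Aaa := A.toBlock (fun i => i ∈ α) (fun i => i ∈ α)
  let Aab := A.toBlock (fun i => i ∈ α) (fun i => ¬ i ∈ α)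
  let Aba := A.toBlock (fun i => ¬ i ∈ α) (fun i => i ∈ α)
  let Abb := A.toBlock (fun i => ¬ i ∈ α) (fun i => ¬ i ∈ α)
  Matrix.reindex (Equiv.sumCompl fun i => i ∈ α) (Equiv.sumCompl fun i => i ∈ α)
    (Matrix.fromBlocks Aaa⁻¹ (-(Aaa⁻¹ * Aab)) (Aba * Aaa⁻¹) (Abb - Aba * Aaa⁻¹ * Aab))

/-- `M` is a (legitimate) principal pivot transform of `A`. -/
def IsPPT {n : ℕ} (A M : Matrix (Fin n) (Fin n) ℝ) : Prop :=
  ∃ α : Finset (Fin n), (principalSubmatrix A α).det ≠ 0 ∧ M = ppt A α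

/-- Exact order `k` `C₀ᶠ`: every PPT is exact order `k` `C₀` or `E₀`, and at least one PPT is
exact order `k` `C₀`. -/
def IsExactOrderC0f {n : ℕ} (k : ℕ) (A : Matrix (Fin n) (Fin n) ℝ) : Prop :=
  (∀ M, IsPPT A M → IsExactOrderC0 k M ∨ IsE0 M) ∧ ∃ M, IsPPT A M ∧ IsExactOrderC0 k M

/-- The number of positive diagonal entries. -/
noncomputable def numPosDiag {n : ℕ} (A : Matrix (Fin n) (Fin n) ℝ) : ℕ :=
  {i : Fin n | 0 < A i i}.ncard

/-! ### Lemke's algorithm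

The augmented system is `w - A z - z₀ d = q` with a covering vector `d > 0`. A basis assigns a
basic variable to each of the `n` rows. Ties in the minimum ratio test are broken
lexicographically, except that the artificial variable `z₀` leaves whenever it is tied. -/

/-- The variables of the augmented system: `w i`, `z i` and the artificial variable `z₀`. -/
inductive LVar (n : ℕ) : Type
  | w (i : Fin n)
  | z (i : Fin n)
  | z0

/-- The complement of a variable (`z₀` has none; the value there plays no role). -/
def LVar.compl {n : ℕ} : LVar n → LVar n
  | .w i => .z i
  | .z i => .w i
  | .z0 => .z0

/-- The column of a variable in `w - A z - z₀ d = q`. -/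
def LVar.column {n : ℕ} (A : Matrix (Fin n) (Fin n) ℝ) (d : Fin n → ℝ) :
    LVar n → Fin n → ℝ
  | .w i => Pi.single i 1
  | .z j => fun i => -A i j
  | .z0 => -d

/-- The basis matrix: column `r` is the column of the basic variable `b r`. -/
def basisMatrix {n : ℕ} (A : Matrix (Fin n) (Fin n) ℝ) (d : Fin n → ℝ) (b : Fin n → LVar n) :
    Matrix (Fin n) (Fin n) ℝ :=
  Matrix.of fun i r => (b r).column A d i

/-- The values of the basic variables. -/
noncomputable def basicValue {n : ℕ} (A : Matrix (Fin n) (Fin n) ℝ) (q d : Fin n → ℝ)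
    (b : Fin n → LVar n) : Fin n → ℝ :=
  (basisMatrix A d b)⁻¹ *ᵥ q

/-- The updated column of the variable `v`: when the nonbasic variable `v` increases at unit
rate, the basic variables decrease at the rates `tableauColumn A d b v`. -/
noncomputable def tableauColumn {n : ℕ} (A : Matrix (Fin n) (Fin n) ℝ) (d : Fin n → ℝ)
    (b : Fin n → LVar n) (v : LVar n) : Fin n → ℝ :=
  (basisMatrix A d b)⁻¹ *ᵥ v.column A d

/-- The row `(basic value, row of the inverse of the basis matrix)` divided by `y i`, ordered
lexicographically. Its first entry is the ordinary ratio. -/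
noncomputable def lexRatio {n : ℕ} (A : Matrix (Fin n) (Fin n) ℝ) (q d : Fin n → ℝ)
    (b : Fin n → LVar n) (y : Fin n → ℝ) (i : Fin n) : Lex (Fin (n + 1) → ℝ) :=
  toLex (Fin.cons (basicValue A q d b i / y i) fun j => (basisMatrix A d b)⁻¹ i j / y i)

open Classical in
/-- The `z`-part of the basic solution of a basis (nonbasic variables are zero). -/
noncomputable def basicZ {n : ℕ} (A : Matrix (Fin n) (Fin n) ℝ) (q d : Fin n → ℝ)
    (b : Fin n → LVar n) : Fin n → ℝ :=
  fun j => ∑ r, if b r = LVar.z j then basicValue A q d b r else 0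

/-- The states of the algorithm: the start, an almost complementary basis `b` together with the
variable `e` that is about to enter it, termination with a complementary solution `z`, and
termination on a ray. -/
inductive LemkeState (n : ℕ) : Type
  | start
  | pivot (b : Fin n → LVar n) (e : LVar n)
  | solution (z : Fin n → ℝ)
  | ray

/-- One step of Lemke's algorithm with covering vector `d`. -/
inductive LemkeStep {n : ℕ} (A : Matrix (Fin n) (Fin n) ℝ) (q d : Fin n → ℝ) :
    LemkeState n → LemkeState n → Prop
  /-- If `q ≥ 0`, then `z = 0` is a solution. -/
  | trivial (hq : 0 ≤ q) : LemkeStep A q d .start (.solution 0)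
  /-- Otherwise `z₀` enters the basis `(w₁, …, wₙ)`; it replaces the `w r` for which
  `q r / d r` is (lexicographically) least, and `z r` is the next entering variable. -/
  | init (r : Fin n) (hq : ¬ 0 ≤ q)
      (hr : ∀ i, lexRatio A q d LVar.w d r ≤ lexRatio A q d LVar.w d i) :
      LemkeStep A q d .start (.pivot (Function.update LVar.w r .z0) (.z r))
  /-- If the entering variable can increase without bound, the algorithm stops on a ray. -/
  | ray (b : Fin n → LVar n) (e : LVar n) (hy : ∀ i, tableauColumn A d b e i ≤ 0) :
      LemkeStep A q d (.pivot b e) .ray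
  /-- If `z₀` attains the minimum ratio, it leaves and a solution has been found. -/
  | solve (b : Fin n → LVar n) (e : LVar n) (r : Fin n) (hb : b r = .z0)
      (hpos : 0 < tableauColumn A d b e r)
      (hmin : ∀ i, 0 < tableauColumn A d b e i →
        basicValue A q d b r / tableauColumn A d b e r ≤
          basicValue A q d b i / tableauColumn A d b e i) :
      LemkeStep A q d (.pivot b e) (.solution (basicZ A q d (Function.update b r e)))
  /-- Otherwise the row `r` with the lexicographically least ratio is the pivot row, and the
  complement of the leaving variable `b r` is the next entering variable. -/
  | next (b : Fin n → LVar n) (e : LVar n) (r : Fin n)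
      (hpos : 0 < tableauColumn A d b e r)
      (hmin : ∀ i, 0 < tableauColumn A d b e i →
        lexRatio A q d b (tableauColumn A d b e) r ≤ lexRatio A q d b (tableauColumn A d b e) i)
      (hz0 : ∀ s, b s = .z0 → 0 < tableauColumn A d b e s →
        basicValue A q d b r / tableauColumn A d b e r <
          basicValue A q d b s / tableauColumn A d b e s) :
      LemkeStep A q d (.pivot b e) (.pivot (Function.update b r e) (b r).compl)

/-- Lemke's algorithm processes LCP`(q, A)`: for every covering vector `d > 0` it stops after
finitely many steps, and it stops either at a solution of LCP`(q, A)` or on a ray, in which case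
LCP`(q, A)` is infeasible. -/
def LemkeProcessable {n : ℕ} (q : Fin n → ℝ) (A : Matrix (Fin n) (Fin n) ℝ) : Prop :=
  ∀ d : Fin n → ℝ, (∀ i, 0 < d i) →
    (¬ ∃ s : ℕ → LemkeState n, s 0 = .start ∧ ∀ t, LemkeStep A q d (s t) (s (t + 1))) ∧
    ∀ s : LemkeState n, Relation.ReflTransGen (LemkeStep A q d) .start s →
      (¬ ∃ s', LemkeStep A q d s s') →
      (∃ z ∈ SOL q A, s = .solution z) ∨ (s = .ray ∧ FEA q A = ∅)

end LCP

/-! An index set γ determines a complementary cone, spanned by the columns of `compMatrix A γ`. A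
solution of LCP(q, A) is a representation of q in such a cone, and the sign of det A_γγ is the
orientation of the cone. The proof runs on `IsE0` and on `IsStar`, a property that `IsE0sTilde`
implies and that every PPT inherits (`IsStar.ppt`).

Processability. Lemke's path cannot cycle: an edge has at most two lexicographically feasible
vertices, so a step can be reversed, and the initial vertex has no predecessor. If the path ends on
a ray, `IsE0` makes the direction of the ray a homogeneous solution, and the vector that `IsStar`
attaches to it is a Farkas certificate of infeasibility. A determinant sign is constant along the
path, so a solution reached by pivoting lies in a cone with det A_γγ > 0 (`exists_pos_cone`).

Nonnegative minors (`isP0_of_ppt`). Suppose det A_αα < 0, and move a generic point q of the cone α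
along q + t·1. For large t the point is positive, and by `IsE0` only the cone ∅, of positive
orientation, contains it. So there is a last parameter τ at which some cone β with det A_ββ < 0
contains the point. The PPT M with respect to β turns β into the nonnegative orthant, and a positive
cone γ of M is the cone β ∆ γ of A, with negative determinant. It therefore suffices to find a
positive cone of M that contains the transformed point for some t > τ. If M is E₀, Lemke's algorithm
for M gives one. Otherwise copositivity of order two, together with `IsStar`, gives one directly on
the far side of the facet crossed at τ (`exists_adjacent_cone`). -/

namespace LCP

/-! ### Complementary matrices, principal pivot transforms and the star property -/

section PrincipalPivot

/-- The complementary matrix of `γ`: the columns of `z i` for `i ∈ γ` and of `w i` for `i ∉ γ`. -/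
def compMatrix {n : ℕ} (A : Matrix (Fin n) (Fin n) ℝ) (γ : Finset (Fin n)) :
    Matrix (Fin n) (Fin n) ℝ :=
  Matrix.of fun i j => if j ∈ γ then -A i j else (1 : Matrix (Fin n) (Fin n) ℝ) i j

/-- `if i ∈ γ then x i else y i` as a vector. -/
def mix {n : ℕ} (γ : Finset (Fin n)) (x y : Fin n → ℝ) : Fin n → ℝ :=
  fun i => if i ∈ γ then x i else y i

variable {n : ℕ} {A : Matrix (Fin n) (Fin n) ℝ}

theorem mix_nonneg {γ : Finset (Fin n)} {x y : Fin n → ℝ} (hx : 0 ≤ x) (hy : 0 ≤ y) :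
    0 ≤ mix γ x y := by
  intro i
  simp only [mix]
  split_ifs
  exacts [hx i, hy i]

theorem det_compMatrix (A : Matrix (Fin n) (Fin n) ℝ) (γ : Finset (Fin n)) :
    (compMatrix A γ).det = (-1) ^ γ.card * (principalSubmatrix A γ).det := by
  classical
  rw [Matrix.twoBlockTriangular_det' (compMatrix A γ) (fun i => i ∈ γ)]
  · have h1 : (compMatrix A γ).toSquareBlockProp (fun i => i ∈ γ) = -principalSubmatrix A γ := by
      ext i j
      simp [compMatrix, Matrix.toSquareBlockProp, principalSubmatrix, Matrix.toBlock, j.2]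
    have h2 : (compMatrix A γ).toSquareBlockProp (fun i => ¬ i ∈ γ) = 1 := by
      ext i j
      simp [compMatrix, Matrix.toSquareBlockProp, j.2, Matrix.one_apply, Subtype.ext_iff]
    have h3 := Matrix.det_neg (principalSubmatrix A γ)
    rw [Fintype.card_coe] at h3
    rw [h1, h2, Matrix.det_one, mul_one, ← h3]
    congr!
  · intro i hi j hj
    have : i ≠ j := fun h => hj (h ▸ hi)
    simp [compMatrix, hj, this]

theorem det_compMatrix_ne_zero {γ : Finset (Fin n)} :
    (compMatrix A γ).det ≠ 0 ↔ (principalSubmatrix A γ).det ≠ 0 := by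
  rw [det_compMatrix]
  simp

theorem det_principalSubmatrix (A : Matrix (Fin n) (Fin n) ℝ) (γ : Finset (Fin n)) :
    (principalSubmatrix A γ).det = (-1) ^ γ.card * (compMatrix A γ).det := by
  rw [det_compMatrix, ← mul_assoc, ← mul_pow]
  simp

theorem compMatrix_empty : compMatrix A ∅ = 1 := by
  ext i j
  simp [compMatrix]

theorem compMatrix_mulVec (γ : Finset (Fin n)) (x : Fin n → ℝ) :
    compMatrix A γ *ᵥ x = mix γ 0 x - A *ᵥ mix γ x 0 := by
  ext i
  have : mix γ 0 x i = ∑ j, (1 : Matrix (Fin n) (Fin n) ℝ) i j * mix γ 0 x j := by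
    simp [Matrix.one_apply]
  simp only [Pi.sub_apply, Matrix.mulVec, dotProduct]
  rw [this, ← Finset.sum_sub_distrib]
  refine Finset.sum_congr rfl fun j _ => ?_
  by_cases h : j ∈ γ <;> simp [compMatrix, mix, h]

theorem compMatrix_mulVec_add_compl (γ : Finset (Fin n)) (v u : Fin n → ℝ) :
    compMatrix A γ *ᵥ v + compMatrix A γᶜ *ᵥ u = mix γ u v - A *ᵥ mix γ v u := by
  rw [compMatrix_mulVec, compMatrix_mulVec]
  have h1 : mix γ u v = mix γ 0 v + mix γᶜ 0 u := by
    ext i; by_cases h : i ∈ γ <;> simp [mix, h]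
  have h2 : mix γ v u = mix γ v 0 + mix γᶜ u 0 := by
    ext i; by_cases h : i ∈ γ <;> simp [mix, h]
  rw [h1, h2, Matrix.mulVec_add]
  abel

/-- Solving w = Az for the exchanged variables gives the PPT. This identity replaces the block
definition in all that follows. -/
theorem compMatrix_mul_ppt {γ : Finset (Fin n)} (h : (principalSubmatrix A γ).det ≠ 0) :
    compMatrix A γ * ppt A γ = -compMatrix A γᶜ := by
  classical
  set e := Equiv.sumCompl fun i => i ∈ γ with he
  set Aaa := A.toBlock (fun i => i ∈ γ) (fun i => i ∈ γ) with haa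
  set Aab := A.toBlock (fun i => i ∈ γ) (fun i => ¬ i ∈ γ) with hab
  set Aba := A.toBlock (fun i => ¬ i ∈ γ) (fun i => i ∈ γ) with hba
  set Abb := A.toBlock (fun i => ¬ i ∈ γ) (fun i => ¬ i ∈ γ) with hbb
  have hu : IsUnit Aaa.det := isUnit_iff_ne_zero.2 h
  have h1 : compMatrix A γ = Matrix.reindex e e (Matrix.fromBlocks (-Aaa) 0 (-Aba) 1) := by
    rw [← Equiv.symm_apply_eq]
    ext i j
    rcases i with ⟨i, hi⟩ | ⟨i, hi⟩ <;> rcases j with ⟨j, hj⟩ | ⟨j, hj⟩ <;>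
      simp [compMatrix, he, haa, hba, hj, Matrix.one_apply, Matrix.toBlock]
    rintro rfl
    exact hj hi
  have h2 : compMatrix A γᶜ = Matrix.reindex e e (Matrix.fromBlocks 1 (-Aab) 0 (-Abb)) := by
    rw [← Equiv.symm_apply_eq]
    ext i j
    rcases i with ⟨i, hi⟩ | ⟨i, hi⟩ <;> rcases j with ⟨j, hj⟩ | ⟨j, hj⟩ <;>
      simp [compMatrix, he, hab, hbb, hj, Matrix.one_apply, Matrix.toBlock]
    rintro rfl
    exact hi hj
  have h3 : ppt A γ = Matrix.reindex e e
      (Matrix.fromBlocks Aaa⁻¹ (-(Aaa⁻¹ * Aab)) (Aba * Aaa⁻¹) (Abb - Aba * Aaa⁻¹ * Aab)) := rfl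
  rw [h1, h2, h3, Matrix.reindex_apply, Matrix.reindex_apply, Matrix.reindex_apply,
    Matrix.submatrix_mul_equiv, Matrix.fromBlocks_multiply]
  change _ = (-Matrix.fromBlocks 1 (-Aab) 0 (-Abb)).submatrix e.symm e.symm
  rw [Matrix.fromBlocks_neg]
  congr 2
  · simp [Matrix.mul_nonsing_inv _ hu]
  · simp [← Matrix.mul_assoc, Matrix.mul_nonsing_inv _ hu]
  · simp
  · simp [Matrix.mul_assoc]

/-- A PPT only changes coordinates by C_β, the matrix `compMatrix A β`: exchanging β and then γ is
exchanging β ∆ γ. -/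
theorem compMatrix_mul_compMatrix_ppt {β : Finset (Fin n)} (h : (principalSubmatrix A β).det ≠ 0)
    (γ : Finset (Fin n)) :
    compMatrix A β * compMatrix (ppt A β) γ = compMatrix A (symmDiff β γ) := by
  ext i j
  by_cases hj : j ∈ γ
  · have h1 := congrFun (congrFun (compMatrix_mul_ppt h) i) j
    have h2 : (compMatrix A β * compMatrix (ppt A β) γ) i j =
        -(compMatrix A β * ppt A β) i j := by
      simp [Matrix.mul_apply, compMatrix, hj]
    rw [h2, h1]
    by_cases hb : j ∈ β <;> simp [compMatrix, hj, hb, Finset.mem_symmDiff]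
  · have h2 : (compMatrix A β * compMatrix (ppt A β) γ) i j =
        (compMatrix A β * (1 : Matrix (Fin n) (Fin n) ℝ)) i j := by
      simp only [Matrix.mul_apply, compMatrix, hj, Matrix.of_apply, if_false]
    rw [h2, Matrix.mul_one]
    by_cases hb : j ∈ β <;> simp [compMatrix, hj, hb, Finset.mem_symmDiff]

theorem neg_one_pow_card_symmDiff (β γ : Finset (Fin n)) :
    (-1 : ℝ) ^ (symmDiff β γ).card = (-1) ^ β.card * (-1) ^ γ.card := by
  have e1 : (symmDiff β γ).card + 2 * (β ∩ γ).card = β.card + γ.card := by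
    have h1 := Finset.card_sdiff_add_card_inter β γ
    have h2 := Finset.card_sdiff_add_card_inter γ β
    have h3 : (symmDiff β γ).card = (β \ γ).card + (γ \ β).card := by
      rw [symmDiff_def, Finset.sup_eq_union, Finset.card_union_of_disjoint]
      exact disjoint_sdiff_sdiff
    rw [Finset.inter_comm] at h2
    omega
  rw [← pow_add, ← e1, pow_add, pow_mul]
  simp

/-- Determinants of the preceding matrix identity; the signs cancel because |β ∆ γ| ≡ |β| + |γ| mod
2. Hence a PPT at a negative minor reverses all orientations. -/
theorem det_principalSubmatrix_symmDiff {β : Finset (Fin n)}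
    (h : (principalSubmatrix A β).det ≠ 0) (γ : Finset (Fin n)) :
    (principalSubmatrix A (symmDiff β γ)).det =
      (principalSubmatrix A β).det * (principalSubmatrix (ppt A β) γ).det := by
  have h1 := congrArg Matrix.det (compMatrix_mul_compMatrix_ppt h γ)
  rw [Matrix.det_mul] at h1
  simp only [det_principalSubmatrix]
  rw [← h1]
  rw [neg_one_pow_card_symmDiff]
  ring

/-- A homogeneous solution of the problem for `A` yields a nonzero dual vector with support
conditions (a form of the second defining condition of the class `L`). -/
def IsStar (A : Matrix (Fin n) (Fin n) ℝ) : Prop :=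
  ∀ z ∈ SOL 0 A, z ≠ 0 → ∃ s : Fin n → ℝ, 0 ≤ s ∧ s ≠ 0 ∧ Aᵀ *ᵥ s ≤ 0 ∧
    (∀ i, s i ≠ 0 → z i ≠ 0) ∧ ∀ i, (Aᵀ *ᵥ s) i ≠ 0 → (A *ᵥ z) i ≠ 0

theorem IsE0sTilde.isStar (h : IsE0sTilde A) : IsStar A := by
  intro z hz hz0
  refine ⟨z, hz.1.1, hz0, ?_, fun _ h => h, h.2 z hz⟩
  have h1 := hz.1.2
  have h2 := hz.2
  rw [zero_add] at h1 h2
  exact h.1.2 z h2 h1 hz.1.1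

theorem mulVec_eq_of_ppt {β : Finset (Fin n)} (h : (principalSubmatrix A β).det ≠ 0)
    (u : Fin n → ℝ) :
    mix β u (ppt A β *ᵥ u) = A *ᵥ mix β (ppt A β *ᵥ u) u := by
  have h1 := compMatrix_mulVec_add_compl (A := A) β (ppt A β *ᵥ u) u
  rw [Matrix.mulVec_mulVec, compMatrix_mul_ppt h, Matrix.neg_mulVec, neg_add_cancel] at h1
  exact (sub_eq_zero.1 h1.symm)

theorem mul_eq_zero_of_mem_SOL {q z : Fin n → ℝ} (h : z ∈ SOL q A) (i : Fin n) :
    z i * (q + A *ᵥ z) i = 0 :=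
  (Finset.sum_eq_zero_iff_of_nonneg fun j _ => mul_nonneg (h.1.1 j) (h.1.2 j)).1 h.2 i
    (Finset.mem_univ i)

/-- Dual form of the exchange, with a sign on β. Paired with u, it is sᵀw = (Aᵀs)ᵀz for the pair w =
Az obtained from u. -/
theorem transpose_ppt_mulVec {β : Finset (Fin n)} (h : (principalSubmatrix A β).det ≠ 0)
    (s : Fin n → ℝ) :
    (ppt A β)ᵀ *ᵥ mix β (-(Aᵀ *ᵥ s)) s = mix β (-s) (Aᵀ *ᵥ s) := by
  refine dotProduct_eq _ _ fun u => ?_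
  have h1 := mulVec_eq_of_ppt h u
  set v := ppt A β *ᵥ u with hv
  have h2 : s ⬝ᵥ mix β u v = (Aᵀ *ᵥ s) ⬝ᵥ mix β v u := by
    rw [h1, Matrix.mulVec_transpose, Matrix.dotProduct_mulVec]
  have h3 : ((ppt A β)ᵀ *ᵥ mix β (-(Aᵀ *ᵥ s)) s) ⬝ᵥ u = mix β (-(Aᵀ *ᵥ s)) s ⬝ᵥ v := by
    rw [Matrix.mulVec_transpose, ← Matrix.dotProduct_mulVec]
  rw [h3]
  set t := Aᵀ *ᵥ s
  rw [← sub_eq_zero]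
  rw [← sub_eq_zero] at h2
  rw [← h2]
  simp only [dotProduct, ← Finset.sum_sub_distrib]
  refine Finset.sum_congr rfl fun i _ => ?_
  by_cases hi : i ∈ β <;> simp [mix, hi]
  ring

/-- Exchanging z and w on β takes homogeneous solutions of the PPT to those of A. The dual vector s
comes back with s and -Aᵀs exchanged on β, which interchanges the two support conditions there. -/
theorem IsStar.ppt (hA : IsStar A) {β : Finset (Fin n)}
    (h : (principalSubmatrix A β).det ≠ 0) : IsStar (ppt A β) := by
  intro u hu hu0
  have hS := mul_eq_zero_of_mem_SOL hu
  have hnn := hu.1.1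
  have hv := hu.1.2
  have h1 := mulVec_eq_of_ppt h u
  simp only [zero_add] at hS hv
  set v := LCP.ppt A β *ᵥ u with hvdef
  have hz : mix β v u ∈ SOL 0 A := by
    refine ⟨⟨mix_nonneg hv hnn, ?_⟩, ?_⟩
    · rw [← h1, zero_add]
      exact mix_nonneg hnn hv
    · rw [← h1, zero_add]
      refine Finset.sum_eq_zero fun i _ => ?_
      have := hS i
      by_cases hi : i ∈ β <;> simp only [mix, hi, if_true, if_false] <;> linarith
  have hz0 : mix β v u ≠ 0 := by
    intro h0
    refine hu0 (funext fun i => ?_)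
    rw [h0, Matrix.mulVec_zero] at h1
    by_cases hi : i ∈ β
    · simpa [mix, hi] using congrFun h1 i
    · simpa [mix, hi] using congrFun h0 i
  obtain ⟨s, hs, hs0, ht, hsz, htw⟩ := hA _ hz hz0
  have key := transpose_ppt_mulVec h s
  refine ⟨mix β (-(Aᵀ *ᵥ s)) s, mix_nonneg (neg_nonneg.2 ht) hs, ?_, ?_, ?_, ?_⟩
  · intro h0
    rw [h0, Matrix.mulVec_zero] at key
    refine hs0 (funext fun i => ?_)
    by_cases hi : i ∈ β
    · simpa [mix, hi] using congrFun key i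
    · simpa [mix, hi] using congrFun h0 i
  · rw [key]
    intro i
    have := hs i
    have := ht i
    by_cases hi : i ∈ β <;> simpa [mix, hi]
  · intro i hi
    by_cases hb : i ∈ β
    · have := htw i (by simpa [mix, hb] using hi)
      rw [← h1] at this
      simpa [mix, hb] using this
    · simpa [mix, hb] using hsz i (by simpa [mix, hb] using hi)
  · intro i hi
    rw [key] at hi
    by_cases hb : i ∈ β
    · simpa [mix, hb] using hsz i (by simpa [mix, hb] using hi)
    · have := htw i (by simpa [mix, hb] using hi)
      rw [← h1] at this
      simpa [mix, hb] using this

end PrincipalPivot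

/-! ### Lexicographic positivity -/

section Lexicographic

/-- A vector is lexicographically positive. -/
def LexPos {m : ℕ} (v : Fin m → ℝ) : Prop :=
  ∃ k, (∀ j < k, v j = 0) ∧ 0 < v k

theorem LexPos.smul {m : ℕ} {v : Fin m → ℝ} (h : LexPos v) {c : ℝ} (hc : 0 < c) :
    LexPos (c • v) := by
  obtain ⟨k, h1, h2⟩ := h
  exact ⟨k, fun j hj => by simp [h1 j hj], by simpa using mul_pos hc h2⟩

theorem LexPos.add {m : ℕ} {v w : Fin m → ℝ} (hv : LexPos v) (hw : LexPos w) :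
    LexPos (v + w) := by
  obtain ⟨k, h1, h2⟩ := hv
  obtain ⟨l, h3, h4⟩ := hw
  rcases lt_trichotomy k l with h | h | h
  · exact ⟨k, fun j hj => by simp [h1 j hj, h3 j (hj.trans h)], by simpa [h3 k h] using h2⟩
  · subst h
    exact ⟨k, fun j hj => by simp [h1 j hj, h3 j hj], by simpa using add_pos h2 h4⟩
  · exact ⟨l, fun j hj => by simp [h3 j hj, h1 j (hj.trans h)], by simpa [h1 l h] using h4⟩

theorem not_lexPos_zero {m : ℕ} : ¬ LexPos (0 : Fin m → ℝ) :=
  fun ⟨_, _, h⟩ => lt_irrefl _ h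

theorem LexPos.head_nonneg {m : ℕ} {v : Fin (m + 1) → ℝ} (h : LexPos v) : 0 ≤ v 0 := by
  obtain ⟨k, h1, h2⟩ := h
  rcases eq_or_ne k 0 with rfl | hk
  · exact h2.le
  · exact (h1 0 (Fin.pos_iff_ne_zero.2 hk)).ge

theorem lexPos_of_head_pos {m : ℕ} {v : Fin (m + 1) → ℝ} (h : 0 < v 0) : LexPos v :=
  ⟨0, fun j hj => absurd hj (Fin.not_lt_zero j), h⟩

theorem lexPos_sub_of_le {m : ℕ} {v w : Fin m → ℝ} (h : toLex v ≤ toLex w) (hne : v ≠ w) :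
    LexPos (w - v) := by
  obtain ⟨k, h1, h2⟩ := lt_of_le_of_ne h fun e => hne (toLex_inj.1 e)
  exact ⟨k, fun j hj => sub_eq_zero.2 (h1 j hj).symm, sub_pos.2 h2⟩

theorem head_le_of_toLex_le {m : ℕ} {v w : Fin (m + 1) → ℝ} (h : toLex v ≤ toLex w) :
    v 0 ≤ w 0 :=
  Pi.apply_le_of_toLex (i := 0) h fun j hj => absurd hj (Fin.not_lt_zero j)

/-! ### Exchange of one column of a basis -/

section Pivot

variable {n : ℕ} {B : Matrix (Fin n) (Fin n) ℝ}

theorem updateCol_mulVec (B : Matrix (Fin n) (Fin n) ℝ) (r : Fin n) (v x : Fin n → ℝ) :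
    B.updateCol r v *ᵥ x = B *ᵥ x + x r • (v - B.col r) := by
  ext i
  have : ∀ j, B.updateCol r v i j * x j =
      B i j * x j + (if j = r then (v i - B i r) * x r else 0) := by
    intro j
    by_cases h : j = r
    · subst h; simp; ring
    · simp [h]
  simp only [Matrix.mulVec, dotProduct, Pi.add_apply, Pi.smul_apply, smul_eq_mul, this,
    Finset.sum_add_distrib, Finset.sum_ite_eq', Finset.mem_univ, if_true, Pi.sub_apply,
    Matrix.col_apply]
  ring

theorem det_updateCol_eq (hB : B.det ≠ 0) (r : Fin n) (v : Fin n → ℝ) :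
    (B.updateCol r v).det = (B⁻¹ *ᵥ v) r * B.det := by
  have hu : IsUnit B.det := isUnit_iff_ne_zero.2 hB
  rw [← Matrix.cramer_apply, Matrix.inv_def, Matrix.smul_mulVec,
    ← Matrix.cramer_eq_adjugate_mulVec, Ring.inverse_eq_inv']
  simp
  field_simp

theorem inv_mulVec_eq {x q : Fin n → ℝ} (hB : B.det ≠ 0) (h : B *ᵥ x = q) : B⁻¹ *ᵥ q = x := by
  rw [← h, Matrix.mulVec_mulVec, Matrix.nonsing_inv_mul _ (isUnit_iff_ne_zero.2 hB),
    Matrix.one_mulVec]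

theorem mulVec_inv_mulVec (hB : B.det ≠ 0) (q : Fin n → ℝ) : B *ᵥ (B⁻¹ *ᵥ q) = q := by
  rw [Matrix.mulVec_mulVec, Matrix.mul_nonsing_inv _ (isUnit_iff_ne_zero.2 hB),
    Matrix.one_mulVec]

theorem inv_updateCol_mulVec (hB : B.det ≠ 0) {r : Fin n} {v : Fin n → ℝ}
    (hr : (B⁻¹ *ᵥ v) r ≠ 0) (q : Fin n → ℝ) (i : Fin n) :
    ((B.updateCol r v)⁻¹ *ᵥ q) i =
      if i = r then (B⁻¹ *ᵥ q) r / (B⁻¹ *ᵥ v) r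
      else (B⁻¹ *ᵥ q) i - (B⁻¹ *ᵥ v) i / (B⁻¹ *ᵥ v) r * (B⁻¹ *ᵥ q) r := by
  set y := B⁻¹ *ᵥ v with hy
  set x := B⁻¹ *ᵥ q with hx
  have hdet : (B.updateCol r v).det ≠ 0 := by
    rw [det_updateCol_eq hB]
    exact mul_ne_zero hr hB
  -- Raise the entering variable to the ratio x r / y r: the old basic variables become x - (x r / y
  -- r) y, which vanishes at r, and slot r now holds the entering variable.
  have key : B.updateCol r v *ᵥ (x - (x r / y r) • y + Pi.single r (x r / y r)) = q := by
    rw [updateCol_mulVec, Matrix.mulVec_add, Matrix.mulVec_sub, Matrix.mulVec_smul, hx, hy,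
      mulVec_inv_mulVec hB, mulVec_inv_mulVec hB, ← hx, ← hy]
    ext k
    simp [Matrix.mulVec_single]
    field_simp
    ring
  rw [inv_mulVec_eq hdet key]
  by_cases h : i = r
  · subst h
    simp
    field_simp
    ring
  · simp [h]
    ring

end Pivot

variable {n : ℕ} (A : Matrix (Fin n) (Fin n) ℝ) (q d : Fin n → ℝ)

/-- The right-hand side `q` followed by the unit vectors. -/
def lexRhs (q : Fin n → ℝ) : Fin (n + 1) → Fin n → ℝ :=
  Fin.cons q fun j => Pi.single j 1

/-- Row `i` of `[B⁻¹ q | B⁻¹]` for the basis `b`. -/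
noncomputable def lexRow (b : Fin n → LVar n) (i : Fin n) : Fin (n + 1) → ℝ :=
  fun k => ((basisMatrix A d b)⁻¹ *ᵥ lexRhs q k) i

theorem lexRow_zero (b : Fin n → LVar n) (i : Fin n) :
    lexRow A q d b i 0 = basicValue A q d b i := rfl

theorem lexRow_succ (b : Fin n → LVar n) (i j : Fin n) :
    lexRow A q d b i j.succ = (basisMatrix A d b)⁻¹ i j := by
  simp [lexRow, lexRhs]

theorem lexRatio_eq (b : Fin n → LVar n) (y : Fin n → ℝ) (i : Fin n) :
    lexRatio A q d b y i = toLex ((y i)⁻¹ • lexRow A q d b i) := by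
  refine congrArg toLex (funext fun k => ?_)
  refine Fin.cases ?_ (fun j => ?_) k
  · simp [lexRow_zero, div_eq_inv_mul]
  · simp [lexRow_succ, div_eq_inv_mul]

/-- Distinct rows of an inverse matrix are linearly independent, so the lexicographic ratio test
never ties. -/
theorem lexRow_smul_ne {b : Fin n → LVar n} (hb : (basisMatrix A d b).det ≠ 0) {i r : Fin n}
    (hir : i ≠ r) {s t : ℝ} (hs : s ≠ 0) : s • lexRow A q d b i ≠ t • lexRow A q d b r := by
  intro h
  have h1 : ∀ j, s * (basisMatrix A d b)⁻¹ i j = t * (basisMatrix A d b)⁻¹ r j := fun j => by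
    simpa [lexRow_succ] using congrFun h j.succ
  have h2 := Matrix.nonsing_inv_mul _ (isUnit_iff_ne_zero.2 hb)
  have h3 : s * ((basisMatrix A d b)⁻¹ * basisMatrix A d b) i i =
      t * ((basisMatrix A d b)⁻¹ * basisMatrix A d b) r i := by
    simp only [Matrix.mul_apply, Finset.mul_sum, ← mul_assoc, h1]
  rw [h2] at h3
  simp [hir.symm] at h3
  exact hs h3

variable {A q d}

theorem basisMatrix_update (b : Fin n → LVar n) (r : Fin n) (e : LVar n) :
    basisMatrix A d (Function.update b r e) =
      (basisMatrix A d b).updateCol r (e.column A d) := by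
  ext i j
  by_cases h : j = r
  · subst h; simp [basisMatrix]
  · simp [basisMatrix, h]

theorem basisMatrix_comp (b : Fin n → LVar n) (σ : Equiv.Perm (Fin n)) :
    basisMatrix A d (b ∘ σ) = (basisMatrix A d b).submatrix id σ := rfl

theorem inv_basisMatrix_comp_mulVec (b : Fin n → LVar n) (σ : Equiv.Perm (Fin n))
    (v : Fin n → ℝ) :
    (basisMatrix A d (b ∘ σ))⁻¹ *ᵥ v = ((basisMatrix A d b)⁻¹ *ᵥ v) ∘ σ := by
  have h := Matrix.inv_submatrix_equiv (basisMatrix A d b) (Equiv.refl (Fin n)) σ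
  rw [Equiv.coe_refl] at h
  rw [basisMatrix_comp, h]
  rfl

theorem lexRow_comp (b : Fin n → LVar n) (σ : Equiv.Perm (Fin n)) (i : Fin n) :
    lexRow A q d (b ∘ σ) i = lexRow A q d b (σ i) :=
  funext fun _ => by rw [lexRow, inv_basisMatrix_comp_mulVec]; rfl

/-! ### Almost complementary bases -/

/-- The variable of the pair `i` that belongs to the complementary basis `γ`. -/
def colVar (γ : Finset (Fin n)) (i : Fin n) : LVar n :=
  if i ∈ γ then .z i else .w i

/-- The complementary basis `γ` with its `j`-th variable replaced by `z₀`. -/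
def acBasis (γ : Finset (Fin n)) (j : Fin n) : Fin n → LVar n :=
  Function.update (colVar γ) j .z0

theorem colVar_ne_z0 (γ : Finset (Fin n)) (i : Fin n) : colVar γ i ≠ .z0 := by
  unfold colVar; split_ifs <;> simp

theorem basisMatrix_colVar (γ : Finset (Fin n)) :
    basisMatrix A d (colVar γ) = compMatrix A γ := by
  ext i j
  by_cases h : j ∈ γ
  · simp [basisMatrix, colVar, compMatrix, h, LVar.column]
  · simp [basisMatrix, colVar, compMatrix, h, LVar.column, Pi.single_apply, Matrix.one_apply]

theorem colVar_symmDiff_of_ne {γ : Finset (Fin n)} {i l : Fin n} (h : i ≠ l) :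
    colVar (symmDiff γ {l}) i = colVar γ i := by
  simp [colVar, Finset.mem_symmDiff, h]

theorem colVar_symmDiff_self (γ : Finset (Fin n)) (l : Fin n) :
    colVar (symmDiff γ {l}) l = (colVar γ l).compl := by
  by_cases h : l ∈ γ <;> simp [colVar, Finset.mem_symmDiff, h, LVar.compl]

/-- Slot l holds `z₀`, so membership of l in γ is invisible. This is the vertex common to the edges
γ and γ ∆ {l}. -/
theorem acBasis_symmDiff (γ : Finset (Fin n)) (l : Fin n) :
    acBasis (symmDiff γ {l}) l = acBasis γ l := by
  ext i
  by_cases h : i = l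
  · subst h; simp [acBasis]
  · simp [acBasis, h, colVar_symmDiff_of_ne h]

/-- A pivot puts the entering variable in row l and leaves `z₀` in row j; the normal form wants them
the other way round. The transposition gives the sign in `det_acBasis`. -/
theorem acBasis_comp_swap {γ : Finset (Fin n)} {j l : Fin n} (h : l ≠ j) :
    acBasis γ l ∘ Equiv.swap j l = Function.update (acBasis γ j) l (colVar γ j) := by
  ext i
  by_cases h1 : i = l
  · subst h1; simp [acBasis, h.symm]
  · by_cases h2 : i = j
    · subst h2; simp [acBasis, h1]
    · simp [acBasis, h1, h2, Equiv.swap_apply_of_ne_of_ne h2 h1]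

theorem det_acBasis {γ : Finset (Fin n)} {j l : Fin n} (h : l ≠ j)
    (hdet : (basisMatrix A d (acBasis γ j)).det ≠ 0) :
    (basisMatrix A d (acBasis γ l)).det =
      -(tableauColumn A d (acBasis γ j) (colVar γ j) l *
        (basisMatrix A d (acBasis γ j)).det) := by
  have h1 : (basisMatrix A d (acBasis γ l ∘ Equiv.swap j l)).det =
      -(basisMatrix A d (acBasis γ l)).det := by
    rw [basisMatrix_comp, Matrix.det_permute', Equiv.Perm.sign_swap h.symm]
    simp
  rw [tableauColumn, ← det_updateCol_eq hdet, ← basisMatrix_update, ← acBasis_comp_swap h, h1,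
    neg_neg]

theorem inv_acBasis_mulVec {γ : Finset (Fin n)} {j l : Fin n} (h : l ≠ j)
    (hdet : (basisMatrix A d (acBasis γ j)).det ≠ 0)
    (hl : tableauColumn A d (acBasis γ j) (colVar γ j) l ≠ 0) (v : Fin n → ℝ) (i : Fin n) :
    ((basisMatrix A d (acBasis γ l))⁻¹ *ᵥ v) (Equiv.swap j l i) =
      if i = l then ((basisMatrix A d (acBasis γ j))⁻¹ *ᵥ v) l /
        tableauColumn A d (acBasis γ j) (colVar γ j) l
      else ((basisMatrix A d (acBasis γ j))⁻¹ *ᵥ v) i -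
        tableauColumn A d (acBasis γ j) (colVar γ j) i /
          tableauColumn A d (acBasis γ j) (colVar γ j) l *
          ((basisMatrix A d (acBasis γ j))⁻¹ *ᵥ v) l := by
  have h1 := inv_updateCol_mulVec hdet hl v i
  rw [← basisMatrix_update, ← acBasis_comp_swap h, inv_basisMatrix_comp_mulVec] at h1
  exact h1

theorem lexRow_acBasis_swap_self {γ : Finset (Fin n)} {j l : Fin n} (h : l ≠ j)
    (hdet : (basisMatrix A d (acBasis γ j)).det ≠ 0)
    (hl : tableauColumn A d (acBasis γ j) (colVar γ j) l ≠ 0) :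
    lexRow A q d (acBasis γ l) j =
      (tableauColumn A d (acBasis γ j) (colVar γ j) l)⁻¹ • lexRow A q d (acBasis γ j) l := by
  ext k
  have := inv_acBasis_mulVec h hdet hl (lexRhs q k) l
  rw [Equiv.swap_apply_right, if_pos rfl] at this
  rw [lexRow, this, div_eq_inv_mul]
  rfl

theorem lexRow_acBasis_swap {γ : Finset (Fin n)} {j l i : Fin n} (h : l ≠ j) (hi : i ≠ l)
    (hdet : (basisMatrix A d (acBasis γ j)).det ≠ 0)
    (hl : tableauColumn A d (acBasis γ j) (colVar γ j) l ≠ 0) :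
    lexRow A q d (acBasis γ l) (Equiv.swap j l i) =
      lexRow A q d (acBasis γ j) i - (tableauColumn A d (acBasis γ j) (colVar γ j) i /
        tableauColumn A d (acBasis γ j) (colVar γ j) l) • lexRow A q d (acBasis γ j) l := by
  ext k
  have := inv_acBasis_mulVec h hdet hl (lexRhs q k) i
  rw [if_neg hi] at this
  rw [lexRow, this]
  rfl

end Lexicographic

/-! ### Vertices of Lemke's path: feasibility, orientation, termination -/

section LemkeVertex

variable {n : ℕ} {A : Matrix (Fin n) (Fin n) ℝ} {q d : Fin n → ℝ}

/-- The almost complementary basis given by `γ` and the missing pair `j` is nonsingular and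
lexicographically feasible. -/
structure IsLexFeasible (A : Matrix (Fin n) (Fin n) ℝ) (q d : Fin n → ℝ) (γ : Finset (Fin n))
    (j : Fin n) : Prop where
  det_ne_zero : (basisMatrix A d (acBasis γ j)).det ≠ 0
  lexPos : ∀ i, LexPos (lexRow A q d (acBasis γ j) i)

theorem IsLexFeasible.basicValue_nonneg {γ : Finset (Fin n)} {j : Fin n}
    (h : IsLexFeasible A q d γ j) (i : Fin n) : 0 ≤ basicValue A q d (acBasis γ j) i :=
  (h.lexPos i).head_nonneg

theorem LexPos.pos_of_smul {m : ℕ} {v : Fin m → ℝ} {c : ℝ} (h : LexPos (c • v))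
    (hv : LexPos v) : 0 < c := by
  by_contra hc
  rcases (not_lt.1 hc).eq_or_lt with rfl | hc
  · rw [zero_smul] at h
    exact not_lexPos_zero h
  · have := h.add (hv.smul (neg_pos.2 hc))
    rw [← add_smul, add_neg_cancel, zero_smul] at this
    exact not_lexPos_zero this

theorem IsLexFeasible.tableauColumn_pos {γ : Finset (Fin n)} {j l : Fin n}
    (hj : IsLexFeasible A q d γ j) (hl : IsLexFeasible A q d γ l) (h : l ≠ j) :
    0 < tableauColumn A d (acBasis γ j) (colVar γ j) l := by
  have h1 := hl.det_ne_zero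
  rw [det_acBasis h hj.det_ne_zero] at h1
  have h2 : tableauColumn A d (acBasis γ j) (colVar γ j) l ≠ 0 :=
    left_ne_zero_of_mul (neg_ne_zero.1 h1)
  have h3 := hl.lexPos j
  rw [lexRow_acBasis_swap_self h hj.det_ne_zero h2] at h3
  exact inv_pos.1 (h3.pos_of_smul (hj.lexPos l))

/-- On the edge `γ` there is at most one lexicographically feasible vertex besides `(γ, l)`. -/
theorem IsLexFeasible.eq_of_ne {γ : Finset (Fin n)} {l j₁ j₂ : Fin n}
    (hl : IsLexFeasible A q d γ l) (h₁ : IsLexFeasible A q d γ j₁)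
    (h₂ : IsLexFeasible A q d γ j₂) (hj₁ : j₁ ≠ l) (hj₂ : j₂ ≠ l) : j₁ = j₂ := by
  by_contra hne
  have p₁ := hl.tableauColumn_pos h₁ hj₁
  have p₂ := hl.tableauColumn_pos h₂ hj₂
  have r₁ := h₁.lexPos (Equiv.swap l j₁ j₂)
  have r₂ := h₂.lexPos (Equiv.swap l j₂ j₁)
  rw [lexRow_acBasis_swap hj₁ (Ne.symm hne) hl.det_ne_zero p₁.ne'] at r₁
  rw [lexRow_acBasis_swap hj₂ hne hl.det_ne_zero p₂.ne'] at r₂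
  -- Each of the two bases being feasible says that its index wins the ratio test against the other.
  -- After scaling, the two differences are opposite, so their sum is zero.
  have := (r₁.smul p₁).add (r₂.smul p₂)
  refine not_lexPos_zero (m := n + 1) ?_
  convert this using 1
  ext k
  simp
  field_simp
  ring

theorem colVar_empty : colVar (∅ : Finset (Fin n)) = LVar.w := by
  ext i
  simp [colVar]

theorem acBasis_singleton (r : Fin n) : acBasis {r} r = Function.update LVar.w r .z0 := by
  rw [← colVar_empty]
  change _ = acBasis ∅ r
  rw [← acBasis_symmDiff ∅ r, ← Finset.bot_eq_empty, bot_symmDiff]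

theorem basisMatrix_acBasis (γ : Finset (Fin n)) (j : Fin n) :
    basisMatrix A d (acBasis γ j) = (compMatrix A γ).updateCol j (-d) := by
  rw [acBasis, basisMatrix_update, basisMatrix_colVar]
  rfl

theorem basisMatrix_acBasis_mulVec (γ : Finset (Fin n)) (j : Fin n) (x : Fin n → ℝ) :
    basisMatrix A d (acBasis γ j) *ᵥ x =
      compMatrix A γ *ᵥ Function.update x j 0 - x j • d := by
  have h : Function.update x j 0 = x - Pi.single j (x j) := by
    ext i
    by_cases h : i = j
    · subst h; simp
    · simp [h]
  rw [basisMatrix_acBasis, updateCol_mulVec, h, Matrix.mulVec_sub]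
  ext i
  simp [Matrix.mulVec_single]
  ring

theorem column_colVar (γ : Finset (Fin n)) (j : Fin n) :
    (colVar γ j).column A d = compMatrix A γ *ᵥ Pi.single j 1 := by
  rw [← basisMatrix_colVar (A := A) (d := d) γ, Matrix.mulVec_single_one]
  rfl

/-- The direction of the edge: the entering variable grows at rate 1, the other basic variables at
rates -y, and `z₀` at rate -y j, where y is the updated entering column. -/
theorem compMatrix_mulVec_update_tableauColumn {γ : Finset (Fin n)} {j : Fin n}
    (hdet : (basisMatrix A d (acBasis γ j)).det ≠ 0) :
    compMatrix A γ *ᵥ Function.update (-tableauColumn A d (acBasis γ j) (colVar γ j)) j 1 =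
      -tableauColumn A d (acBasis γ j) (colVar γ j) j • d := by
  have h1 := mulVec_inv_mulVec hdet ((colVar γ j).column A d)
  change _ *ᵥ tableauColumn A d (acBasis γ j) (colVar γ j) = _ at h1
  set y := tableauColumn A d (acBasis γ j) (colVar γ j)
  rw [basisMatrix_acBasis_mulVec, column_colVar] at h1
  have h : Function.update (-y) j 1 = Pi.single j 1 - Function.update y j 0 := by
    ext i
    by_cases h : i = j
    · subst h; simp
    · simp [h]
  rw [h, Matrix.mulVec_sub, ← h1]
  simp

/-- The edge ∅ is the initial ray: its direction is a positive multiple of d, so no basic variable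
decreases along it and there is no second vertex. -/
theorem eq_of_isLexFeasible_empty (hd : ∀ i, 0 < d i) {l r : Fin n}
    (hl : IsLexFeasible A q d ∅ l) (hr : IsLexFeasible A q d ∅ r) : r = l := by
  by_contra h
  have h1 := hl.tableauColumn_pos hr h
  have h2 := compMatrix_mulVec_update_tableauColumn hl.det_ne_zero
  rw [compMatrix_empty, Matrix.one_mulVec] at h2
  have h3 := congrFun h2 l
  have h4 := congrFun h2 r
  simp [h] at h3 h4
  have := hd l
  have := hd r
  have h5 : -tableauColumn A d (acBasis ∅ l) (colVar ∅ l) l > 0 := by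
    by_contra h6
    nlinarith
  nlinarith

theorem IsLexFeasible.next {γ : Finset (Fin n)} {j l : Fin n} (hj : IsLexFeasible A q d γ j)
    (h : l ≠ j) (hl : 0 < tableauColumn A d (acBasis γ j) (colVar γ j) l)
    (hmin : ∀ i, 0 < tableauColumn A d (acBasis γ j) (colVar γ j) i →
      lexRatio A q d (acBasis γ j) (tableauColumn A d (acBasis γ j) (colVar γ j)) l ≤
        lexRatio A q d (acBasis γ j) (tableauColumn A d (acBasis γ j) (colVar γ j)) i) :
    IsLexFeasible A q d γ l := by
  have hdet := hj.det_ne_zero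
  refine ⟨?_, fun i => ?_⟩
  · rw [det_acBasis h hdet]
    exact neg_ne_zero.2 (mul_ne_zero hl.ne' hdet)
  obtain ⟨i, rfl⟩ := (Equiv.swap j l).surjective i
  by_cases hi : i = l
  · subst hi
    rw [Equiv.swap_apply_right, lexRow_acBasis_swap_self h hdet hl.ne']
    exact (hj.lexPos i).smul (inv_pos.2 hl)
  rw [lexRow_acBasis_swap h hi hdet hl.ne']
  set y := tableauColumn A d (acBasis γ j) (colVar γ j)
  rcases lt_trichotomy (y i) 0 with hy | hy | hy
  · rw [sub_eq_add_neg, ← neg_smul]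
    exact (hj.lexPos i).add ((hj.lexPos l).smul (neg_pos.2 (div_neg_of_neg_of_pos hy hl)))
  · rw [hy, zero_div, zero_smul, sub_zero]
    exact hj.lexPos i
  · have h1 := hmin i hy
    rw [lexRatio_eq, lexRatio_eq] at h1
    have h2 := lexPos_sub_of_le h1 (lexRow_smul_ne A q d hdet (Ne.symm hi) (inv_ne_zero hl.ne'))
    convert h2.smul hy using 1
    rw [smul_sub, smul_smul, smul_smul, mul_inv_cancel₀ hy.ne', one_smul, div_eq_mul_inv]

/-- The invariant of the vertices visited by Lemke's algorithm: lexicographic feasibility,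
`z₀ > 0`, and positive orientation. -/
structure IsLemkeVertex (A : Matrix (Fin n) (Fin n) ℝ) (q d : Fin n → ℝ) (γ : Finset (Fin n))
    (j : Fin n) : Prop extends IsLexFeasible A q d γ j where
  z0_pos : 0 < basicValue A q d (acBasis γ j) j
  orientation : 0 < (-1) ^ γ.card * (basisMatrix A d (acBasis γ j)).det

/-- The orientation persists because the determinant changes sign together with (-1)^|γ|; `z₀` stays
positive because its ratio is strictly larger than the minimum. -/
theorem IsLemkeVertex.next {γ : Finset (Fin n)} {j l : Fin n} (hj : IsLemkeVertex A q d γ j)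
    (h : l ≠ j) (hl : 0 < tableauColumn A d (acBasis γ j) (colVar γ j) l)
    (hmin : ∀ i, 0 < tableauColumn A d (acBasis γ j) (colVar γ j) i →
      lexRatio A q d (acBasis γ j) (tableauColumn A d (acBasis γ j) (colVar γ j)) l ≤
        lexRatio A q d (acBasis γ j) (tableauColumn A d (acBasis γ j) (colVar γ j)) i)
    (hz0 : 0 < tableauColumn A d (acBasis γ j) (colVar γ j) j →
      basicValue A q d (acBasis γ j) l / tableauColumn A d (acBasis γ j) (colVar γ j) l <
        basicValue A q d (acBasis γ j) j / tableauColumn A d (acBasis γ j) (colVar γ j) j) :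
    IsLemkeVertex A q d (symmDiff γ {l}) l := by
  have hf := hj.toIsLexFeasible.next h hl hmin
  have hdet := hj.det_ne_zero
  refine ⟨⟨?_, ?_⟩, ?_, ?_⟩
  · rw [acBasis_symmDiff]
    exact hf.det_ne_zero
  · rw [acBasis_symmDiff]
    exact hf.lexPos
  · rw [acBasis_symmDiff]
    have h1 := inv_acBasis_mulVec h hdet hl.ne' q j
    rw [Equiv.swap_apply_left, if_neg h.symm] at h1
    change basicValue A q d (acBasis γ l) l = basicValue A q d (acBasis γ j) j - _ *
      basicValue A q d (acBasis γ j) l at h1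
    rw [h1]
    have h2 := hj.basicValue_nonneg l
    have h3 := hj.z0_pos
    set y := tableauColumn A d (acBasis γ j) (colVar γ j)
    rcases le_or_gt (y j) 0 with hy | hy
    · have := mul_nonneg (div_nonneg (neg_nonneg.2 hy) hl.le) h2
      rw [neg_div] at this
      linarith
    · have h4 := hz0 hy
      rw [div_lt_div_iff₀ hl hy] at h4
      rw [sub_pos, div_mul_eq_mul_div, div_lt_iff₀ hl]
      linarith
  · rw [acBasis_symmDiff, neg_one_pow_card_symmDiff, det_acBasis h hdet]
    have := mul_pos hl hj.orientation
    simp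
    linarith

theorem isLemkeVertex_init (hd : ∀ i, 0 < d i) (hq : ¬ 0 ≤ q) {r : Fin n}
    (hr : ∀ i, lexRatio A q d LVar.w d r ≤ lexRatio A q d LVar.w d i) :
    IsLemkeVertex A q d {r} r := by
  have h1 : basisMatrix A d LVar.w = 1 := by
    rw [← colVar_empty, basisMatrix_colVar, compMatrix_empty]
  have h2 : basisMatrix A d (acBasis {r} r) =
      (1 : Matrix (Fin n) (Fin n) ℝ).updateCol r (-d) := by
    rw [acBasis_singleton, basisMatrix_update, h1]
    rfl
  have hdr := hd r
  have hw : ∀ i k, lexRow A q d LVar.w i k = lexRhs q k i := fun i k => by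
    simp [lexRow, h1]
  have hinv : ∀ i v, ((basisMatrix A d (acBasis {r} r))⁻¹ *ᵥ v) i =
      if i = r then -(v r / d r) else v i - d i / d r * v r := by
    intro i v
    rw [h2, inv_updateCol_mulVec (by simp) (by simpa using hdr.ne')]
    simp [div_neg, sub_eq_add_neg, neg_div]
  have hdet : (basisMatrix A d (acBasis {r} r)).det = -d r := by
    rw [h2, det_updateCol_eq (by simp)]
    simp
  have hqr : q r < 0 := by
    by_contra h
    refine hq fun i => ?_
    have h3 := hr i
    rw [lexRatio_eq, lexRatio_eq] at h3
    have h4 := head_le_of_toLex_le h3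
    simp only [Pi.smul_apply, hw, lexRhs, Fin.cons_zero, smul_eq_mul] at h4
    have h5 := inv_pos.2 (hd i)
    have h6 : 0 ≤ (d r)⁻¹ * q r := mul_nonneg (inv_pos.2 hdr).le (not_lt.1 h)
    exact le_of_mul_le_mul_left (by simpa using h6.trans h4) h5
  have hz : 0 < basicValue A q d (acBasis {r} r) r := by
    rw [basicValue, hinv, if_pos rfl, neg_pos]
    exact div_neg_of_neg_of_pos hqr hdr
  refine ⟨⟨?_, fun i => ?_⟩, hz, ?_⟩
  · rw [hdet]
    exact neg_ne_zero.2 hdr.ne'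
  · by_cases hi : i = r
    · subst hi
      exact lexPos_of_head_pos hz
    · have h3 := hr i
      rw [lexRatio_eq, lexRatio_eq] at h3
      have h4 := lexPos_sub_of_le h3 (lexRow_smul_ne A q d (by simp [h1]) (Ne.symm hi)
        (inv_ne_zero hdr.ne'))
      convert h4.smul (hd i) using 1
      ext k
      have := (hd i).ne'
      rw [lexRow, hinv, if_neg hi]
      simp only [Pi.smul_apply, Pi.sub_apply, hw, smul_eq_mul]
      field_simp
  · rw [hdet]
    simpa using hdr

/-- On a ray the problem is infeasible. -/
theorem IsLemkeVertex.FEA_eq_empty {γ : Finset (Fin n)} {j : Fin n}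
    (hj : IsLemkeVertex A q d γ j) (hE : IsE0 A) (hS : IsStar A) (hd : ∀ i, 0 < d i)
    (hy : ∀ i, tableauColumn A d (acBasis γ j) (colVar γ j) i ≤ 0) : FEA q A = ∅ := by
  have hη := compMatrix_mulVec_update_tableauColumn hj.det_ne_zero
  have hx := mulVec_inv_mulVec hj.det_ne_zero q
  change _ *ᵥ basicValue A q d (acBasis γ j) = q at hx
  rw [basisMatrix_acBasis_mulVec] at hx
  have hx0 := hj.z0_pos
  have hxn : 0 ≤ Function.update (basicValue A q d (acBasis γ j)) j 0 := by
    intro i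
    by_cases h : i = j
    · subst h; simp
    · simpa [h] using hj.basicValue_nonneg i
  set x := Function.update (basicValue A q d (acBasis γ j)) j 0
  set t := basicValue A q d (acBasis γ j) j
  set y := tableauColumn A d (acBasis γ j) (colVar γ j)
  have hηn : 0 ≤ Function.update (-y) j 1 := by
    intro i
    by_cases h : i = j
    · subst h; simp
    · simpa [h] using hy i
  have hηj : Function.update (-y) j 1 j = 1 := by simp
  have hτ := neg_nonneg.2 (hy j)
  set η := Function.update (-y) j 1
  set τ := -y j
  rw [compMatrix_mulVec] at hη hx
  -- With zero z-part the ray would be the initial one, γ = ∅, whose basis has determinant -d j; the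
  -- orientation excludes this.
  have hz0 : mix γ η 0 ≠ 0 := by
    intro h0
    rw [h0, Matrix.mulVec_zero, sub_zero] at hη
    have hjγ : j ∉ γ := fun hjγ => by
      have := congrFun h0 j
      simp [mix, hjγ, hηj] at this
    have h1 := congrFun hη j
    simp [mix, hjγ, hηj] at h1
    have hτ0 : τ ≠ 0 := by rintro h; simp [h] at h1
    have hγ : γ = ∅ := by
      refine Finset.eq_empty_of_forall_notMem fun i hi => ?_
      have h2 := congrFun hη i
      simp [mix, hi, hτ0, (hd i).ne'] at h2
    have ho := hj.orientation
    subst hγ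
    rw [basisMatrix_acBasis, compMatrix_empty, det_updateCol_eq (by simp)] at ho
    simp at ho
    linarith [hd j]
  have hzn : 0 ≤ mix γ η 0 := mix_nonneg hηn le_rfl
  obtain ⟨i, hi, hAi⟩ := hE _ hzn hz0
  have hiγ : i ∈ γ := by
    by_contra h
    simp [mix, h] at hi
  -- On γ the w-part of the direction is zero, so row i reads -(Az)ᵢ = τ dᵢ. Semimonotonicity makes
  -- the left side nonpositive.
  have hτ0 : τ = 0 := by
    have h1 := congrFun hη i
    simp only [mix, hiγ, if_true, Pi.sub_apply, Pi.zero_apply, zero_sub, Pi.smul_apply,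
      smul_eq_mul] at h1
    change -(A *ᵥ mix γ η 0) i = _ at h1
    have := hd i
    by_contra h
    have := mul_pos (lt_of_le_of_ne hτ (Ne.symm h)) this
    linarith
  rw [hτ0, zero_smul] at hη
  have hw : mix γ 0 η = A *ᵥ mix γ η 0 := sub_eq_zero.1 hη
  have hsol : mix γ η 0 ∈ SOL 0 A := by
    refine ⟨⟨hzn, ?_⟩, ?_⟩
    · rw [← hw, zero_add]
      exact mix_nonneg le_rfl hηn
    · rw [← hw, zero_add]
      refine Finset.sum_eq_zero fun i _ => ?_
      by_cases h : i ∈ γ <;> simp [mix, h]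
  obtain ⟨s, hs, hs0, hAs, hsz, hsw⟩ := hS _ hsol hz0
  rw [← hw] at hsw
  have hsd : 0 < s ⬝ᵥ d := by
    obtain ⟨i, hi⟩ := Function.ne_iff.1 hs0
    exact Finset.sum_pos' (fun k _ => mul_nonneg (hs k) (hd k).le)
      ⟨i, Finset.mem_univ i, mul_pos (lt_of_le_of_ne (hs i) (Ne.symm hi)) (hd i)⟩
  -- The support conditions make s orthogonal to the w-part and Aᵀs orthogonal to the z-part of the
  -- vertex. In sᵀq only -z₀ sᵀd remains.
  have hsq : s ⬝ᵥ q < 0 := by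
    rw [← hx, dotProduct_sub, dotProduct_sub, Matrix.dotProduct_mulVec, ← Matrix.mulVec_transpose,
      dotProduct_smul]
    have h1 : s ⬝ᵥ mix γ 0 x = 0 := by
      refine Finset.sum_eq_zero fun i _ => ?_
      by_cases h : i ∈ γ
      · simp [mix, h]
      · have : s i = 0 := by
          by_contra h2
          exact hsz i h2 (by simp [mix, h])
        simp [this]
    have h2 : (Aᵀ *ᵥ s) ⬝ᵥ mix γ x 0 = 0 := by
      refine Finset.sum_eq_zero fun i _ => ?_
      by_cases h : i ∈ γ
      · have : (Aᵀ *ᵥ s) i = 0 := by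
          by_contra h2
          exact hsw i h2 (by simp [mix, h])
        simp [this]
      · simp [mix, h]
    rw [h1, h2]
    have := mul_pos hx0 hsd
    simp
    linarith
  refine Set.eq_empty_of_forall_notMem fun z hz => ?_
  have h1 : 0 ≤ s ⬝ᵥ (q + A *ᵥ z) := dotProduct_nonneg_of_nonneg hs hz.2
  rw [dotProduct_add, Matrix.dotProduct_mulVec, ← Matrix.mulVec_transpose] at h1
  have h2 : 0 ≤ (-(Aᵀ *ᵥ s)) ⬝ᵥ z := dotProduct_nonneg_of_nonneg (neg_nonneg.2 hAs) hz.1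
  rw [neg_dotProduct] at h2
  linarith

/-- When `z₀` leaves, a complementary feasible basis of positive orientation is reached. -/
theorem IsLemkeVertex.solve {γ : Finset (Fin n)} {j : Fin n}
    (hj : IsLemkeVertex A q d γ j)
    (hpos : 0 < tableauColumn A d (acBasis γ j) (colVar γ j) j)
    (hmin : ∀ i, 0 < tableauColumn A d (acBasis γ j) (colVar γ j) i →
      basicValue A q d (acBasis γ j) j / tableauColumn A d (acBasis γ j) (colVar γ j) j ≤
        basicValue A q d (acBasis γ j) i / tableauColumn A d (acBasis γ j) (colVar γ j) i) :
    0 < (principalSubmatrix A γ).det ∧ 0 ≤ (compMatrix A γ)⁻¹ *ᵥ q := by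
  have hdet := hj.det_ne_zero
  have h1 : compMatrix A γ =
      (basisMatrix A d (acBasis γ j)).updateCol j ((colVar γ j).column A d) := by
    rw [← basisMatrix_update, acBasis, Function.update_idem, Function.update_eq_self,
      basisMatrix_colVar]
  constructor
  · rw [det_principalSubmatrix, h1, det_updateCol_eq hdet]
    have := mul_pos hpos hj.orientation
    change 0 < _ * (tableauColumn A d (acBasis γ j) (colVar γ j) j * _)
    linarith
  · intro i
    rw [h1, inv_updateCol_mulVec hdet hpos.ne']
    change 0 ≤ if i = j then basicValue A q d (acBasis γ j) j / _ else
      basicValue A q d (acBasis γ j) i - _ * basicValue A q d (acBasis γ j) j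
    have h2 := hj.basicValue_nonneg i
    have h3 := hj.z0_pos
    change 0 < tableauColumn A d (acBasis γ j) (colVar γ j) j at hpos
    split_ifs with h
    · exact (div_pos h3 hpos).le
    · change 0 ≤ _ - tableauColumn A d (acBasis γ j) (colVar γ j) i /
        tableauColumn A d (acBasis γ j) (colVar γ j) j * _
      set y := tableauColumn A d (acBasis γ j) (colVar γ j)
      rcases le_or_gt (y i) 0 with hy | hy
      · have := mul_nonneg (div_nonneg (neg_nonneg.2 hy) hpos.le) h3.le
        rw [neg_div] at this
        linarith
      · have h4 := hmin i hy
        rw [div_le_div_iff₀ hpos hy] at h4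
        rw [sub_nonneg, div_mul_eq_mul_div, div_le_iff₀ hpos]
        linarith

end LemkeVertex

/-! ### Lemke's path: finiteness and correctness -/

section LemkePath

variable {n : ℕ} {A : Matrix (Fin n) (Fin n) ℝ} {q d : Fin n → ℝ}

/-- The state `s` is, up to the order of the rows, the vertex given by `γ` and `j`. -/
def LemkeState.IsAt (A : Matrix (Fin n) (Fin n) ℝ) (q d : Fin n → ℝ) (s : LemkeState n)
    (x : Finset (Fin n) × Fin n) : Prop :=
  IsLemkeVertex A q d x.1 x.2 ∧ ∃ (b : Fin n → LVar n) (σ : Equiv.Perm (Fin n)),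
    s = .pivot b (colVar x.1 x.2) ∧ b ∘ σ = acBasis x.1 x.2

/-- Consecutive vertices of the path. -/
def IsNextVertex (A : Matrix (Fin n) (Fin n) ℝ) (q d : Fin n → ℝ)
    (x y : Finset (Fin n) × Fin n) : Prop :=
  ∃ l, l ≠ x.2 ∧ y = (symmDiff x.1 {l}, l) ∧ IsLexFeasible A q d x.1 x.2 ∧
    IsLexFeasible A q d x.1 l

/-- The target determines l and the edge γ, and this edge has only one possible vertex besides (γ,
l). -/
theorem IsNextVertex.left_unique {x x' y : Finset (Fin n) × Fin n}
    (h : IsNextVertex A q d x y) (h' : IsNextVertex A q d x' y) : x = x' := by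
  obtain ⟨γ, j⟩ := x
  obtain ⟨γ', j'⟩ := x'
  obtain ⟨l, hl, rfl, h1, h2⟩ := h
  obtain ⟨l', hl', he, h1', -⟩ := h'
  obtain ⟨he, rfl⟩ := Prod.mk.inj he
  obtain rfl : γ = γ' := symmDiff_left_injective _ he
  exact congrArg (γ, ·) (h2.eq_of_ne h1 h1' hl.symm hl'.symm)

theorem not_isNextVertex_init (hd : ∀ i, 0 < d i) (x : Finset (Fin n) × Fin n) (r : Fin n) :
    ¬ IsNextVertex A q d x ({r}, r) := by
  obtain ⟨γ, j⟩ := x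
  rintro ⟨l, hl, he, h1, h2⟩
  obtain ⟨he, rfl⟩ := Prod.mk.inj he
  have : γ = ∅ := by
    rw [eq_comm, symmDiff_eq_right] at he
    exact he
  subst this
  exact hl (eq_of_isLexFeasible_empty hd h1 h2)

theorem isAt_init (hd : ∀ i, 0 < d i) (hq : ¬ 0 ≤ q) {r : Fin n}
    (hr : ∀ i, lexRatio A q d LVar.w d r ≤ lexRatio A q d LVar.w d i) :
    (LemkeState.pivot (Function.update LVar.w r .z0) (.z r)).IsAt A q d ({r}, r) :=
  ⟨isLemkeVertex_init hd hq hr, Function.update LVar.w r .z0, 1, by simp [colVar],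
    (acBasis_singleton r).symm⟩

/-- The algorithm keeps its own order of rows; σ records the difference from the normal form, and
each pivot multiplies it by a transposition. -/
theorem LemkeState.IsAt.next {b b' : Fin n → LVar n} {e e' : LVar n}
    {x : Finset (Fin n) × Fin n} (hx : (LemkeState.pivot b e).IsAt A q d x)
    (hs : LemkeStep A q d (.pivot b e) (.pivot b' e')) :
    ∃ y, (LemkeState.pivot b' e').IsAt A q d y ∧ IsNextVertex A q d x y := by
  obtain ⟨γ, j⟩ := x
  obtain ⟨hV, b, σ, he, hσ⟩ := hx
  obtain ⟨rfl, rfl⟩ := LemkeState.pivot.inj he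
  cases hs with
  | next _ _ r hpos hmin hz0 =>
    obtain ⟨l, rfl⟩ := σ.surjective r
    have hb : ∀ i, b (σ i) = acBasis γ j i := fun i => congrFun hσ i
    have hy : ∀ i, tableauColumn A d b (colVar γ j) (σ i) =
        tableauColumn A d (acBasis γ j) (colVar γ j) i := fun i => by
      rw [tableauColumn, tableauColumn, ← hσ, inv_basisMatrix_comp_mulVec]; rfl
    have hv : ∀ i, basicValue A q d b (σ i) = basicValue A q d (acBasis γ j) i := fun i => by
      rw [basicValue, basicValue, ← hσ, inv_basisMatrix_comp_mulVec]; rfl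
    have hr : ∀ i, lexRatio A q d b (tableauColumn A d b (colVar γ j)) (σ i) =
        lexRatio A q d (acBasis γ j) (tableauColumn A d (acBasis γ j) (colVar γ j)) i :=
      fun i => by rw [lexRatio_eq, lexRatio_eq, hy, ← hσ, lexRow_comp]
    simp only at hpos hmin hz0
    rw [hy] at hpos
    have hz0' := hz0 (σ j) (by rw [hb]; simp [acBasis])
    rw [hy, hy, hv, hv] at hz0'
    -- The strict inequality for the row of `z₀`, applied to that row itself, would be irreflexive.
    have hlj : l ≠ j := by
      rintro rfl
      exact lt_irrefl _ (hz0' hpos)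
    have hmin' : ∀ i, 0 < tableauColumn A d (acBasis γ j) (colVar γ j) i →
        lexRatio A q d (acBasis γ j) (tableauColumn A d (acBasis γ j) (colVar γ j)) l ≤
        lexRatio A q d (acBasis γ j) (tableauColumn A d (acBasis γ j) (colVar γ j)) i := by
      intro i hi
      rw [← hr, ← hr]
      exact hmin _ (by rwa [hy])
    refine ⟨(symmDiff γ {l}, l), ⟨hV.next hlj hpos hmin' hz0',
      Function.update b (σ l) (colVar γ j), σ * Equiv.swap j l, ?_, ?_⟩,
      l, hlj, rfl, hV.toIsLexFeasible, hV.toIsLexFeasible.next hlj hpos hmin'⟩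
    · rw [colVar_symmDiff_self, hb, acBasis, Function.update_of_ne hlj]
    · rw [acBasis_symmDiff, Equiv.Perm.coe_mul, ← Function.comp_assoc]
      have : Function.update b (σ l) (colVar γ j) ∘ σ = acBasis γ l ∘ Equiv.swap j l := by
        rw [acBasis_comp_swap hlj, ← hσ, Function.update_comp_eq_of_injective _ σ.injective]
      rw [this, Function.comp_assoc, ← Equiv.Perm.coe_mul, Equiv.swap_mul_self]
      rfl

/-- Lemke's algorithm is finite. -/
theorem not_exists_infinite_lemke (hd : ∀ i, 0 < d i) :
    ¬ ∃ s : ℕ → LemkeState n, s 0 = .start ∧ ∀ t, LemkeStep A q d (s t) (s (t + 1)) := by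
  rintro ⟨s, h0, hs⟩
  have hpiv : ∀ t, ∃ b e, s (t + 1) = .pivot b e := by
    intro t
    have h1 := hs (t + 1)
    have h2 := hs t
    generalize s t = u, s (t + 1) = v, s (t + 1 + 1) = v' at h1 h2
    cases h1 with
    | trivial => cases h2
    | init => cases h2
    | ray => exact ⟨_, _, rfl⟩
    | solve => exact ⟨_, _, rfl⟩
    | next => exact ⟨_, _, rfl⟩
  obtain ⟨r, hr⟩ : ∃ r, (s 1).IsAt A q d ({r}, r) := by
    have h1 := hs 0
    obtain ⟨b, e, he⟩ := hpiv 0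
    rw [h0, zero_add, he] at h1
    rw [zero_add] at he
    cases h1 with
    | init r hq hr =>
      exact ⟨r, he ▸ isAt_init hd hq hr⟩
  have hstep : ∀ t x, (s (t + 1)).IsAt A q d x →
      ∃ y, (s (t + 1 + 1)).IsAt A q d y ∧ IsNextVertex A q d x y := by
    intro t x hx
    have h1 := hs (t + 1)
    obtain ⟨b, e, he⟩ := hpiv t
    obtain ⟨b', e', he'⟩ := hpiv (t + 1)
    rw [he] at hx h1
    rw [he'] at h1 ⊢
    exact hx.next h1
  choose nxt hnxt using hstep
  let f : (t : ℕ) → {x // (s (t + 1)).IsAt A q d x} := fun t =>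
    Nat.rec ⟨_, hr⟩ (fun t p => ⟨nxt t p.1 p.2, (hnxt t p.1 p.2).1⟩) t
  obtain ⟨g, hg0, hg⟩ : ∃ g : ℕ → Finset (Fin n) × Fin n, g 0 = ({r}, r) ∧
      ∀ t, IsNextVertex A q d (g t) (g (t + 1)) :=
    ⟨fun t => (f t).1, rfl, fun t => (hnxt t (f t).1 (f t).2).2⟩
  -- A repetition can be shifted back step by step until it involves the initial vertex, which has
  -- no predecessor.
  have key : ∀ i m, g i ≠ g (i + m + 1) := by
    intro i
    induction i with
    | zero =>
      intro m h
      have h1 := hg m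
      rw [zero_add] at h
      rw [← h, hg0] at h1
      exact not_isNextVertex_init hd _ _ h1
    | succ i ih =>
      intro m h
      have h1 := hg i
      have h2 := hg (i + m + 1)
      rw [show i + m + 1 + 1 = i + 1 + m + 1 by omega, ← h] at h2
      exact ih m (h1.left_unique h2)
  obtain ⟨i, j, hij, he⟩ := Finite.exists_ne_map_eq_of_infinite g
  rcases lt_or_gt_of_ne hij with h | h
  · obtain ⟨m, rfl⟩ := Nat.exists_eq_add_of_lt h
    exact key i m he
  · obtain ⟨m, rfl⟩ := Nat.exists_eq_add_of_lt h
    exact key j m he.symm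

theorem exists_lemkeStep_start (A : Matrix (Fin n) (Fin n) ℝ) (q d : Fin n → ℝ) :
    ∃ s, LemkeStep A q d .start s := by
  by_cases hq : 0 ≤ q
  · exact ⟨_, .trivial hq⟩
  · have : Nonempty (Fin n) := by
      by_contra h
      rw [not_nonempty_iff] at h
      exact hq fun i => isEmptyElim i
    obtain ⟨r, hr⟩ := Finite.exists_min (lexRatio A q d LVar.w d)
    exact ⟨_, .init r hq hr⟩

/-- Take the lexicographic minimizer r. Either `z₀` has a strictly larger ratio whenever it is
eligible, or it attains the minimum ratio. -/
theorem exists_lemkeStep_pivot (A : Matrix (Fin n) (Fin n) ℝ) (q d : Fin n → ℝ)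
    (b : Fin n → LVar n) (e : LVar n) : ∃ s, LemkeStep A q d (.pivot b e) s := by
  classical
  by_cases hy : ∀ i, tableauColumn A d b e i ≤ 0
  · exact ⟨_, .ray b e hy⟩
  push Not at hy
  obtain ⟨i₀, hi₀⟩ := hy
  obtain ⟨r, hr, hmin⟩ := Finset.exists_min_image
    (Finset.univ.filter fun i => 0 < tableauColumn A d b e i)
    (lexRatio A q d b (tableauColumn A d b e)) ⟨i₀, by simpa using hi₀⟩
  simp only [Finset.mem_filter, Finset.mem_univ, true_and] at hr hmin
  by_cases hz : ∀ s, b s = .z0 → 0 < tableauColumn A d b e s →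
      basicValue A q d b r / tableauColumn A d b e r <
        basicValue A q d b s / tableauColumn A d b e s
  · exact ⟨_, .next b e r hr hmin hz⟩
  · push Not at hz
    obtain ⟨s, hbs, hs, hle⟩ := hz
    exact ⟨_, .solve b e s hbs hs fun i hi => hle.trans (head_le_of_toLex_le (hmin i hi))⟩

theorem basicZ_comp (b : Fin n → LVar n) (σ : Equiv.Perm (Fin n)) :
    basicZ A q d (b ∘ σ) = basicZ A q d b := by
  ext j
  simp only [basicZ]
  refine Eq.trans ?_ (Equiv.sum_comp σ _)
  refine Finset.sum_congr rfl fun i _ => ?_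
  rw [basicValue, inv_basisMatrix_comp_mulVec]
  rfl

theorem basicZ_colVar (γ : Finset (Fin n)) :
    basicZ A q d (colVar γ) = mix γ ((compMatrix A γ)⁻¹ *ᵥ q) 0 := by
  ext j
  simp only [basicZ, basicValue, basisMatrix_colVar]
  have : ∀ r, colVar γ r = LVar.z j ↔ r = j ∧ j ∈ γ := by
    intro r
    unfold colVar
    by_cases h : r ∈ γ
    · simp only [h, if_true, LVar.z.injEq]
      exact ⟨fun e => ⟨e, e ▸ h⟩, fun e => e.1⟩
    · simp only [h, if_false, reduceCtorEq, false_iff]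
      rintro ⟨rfl, h'⟩
      exact h h'
  simp only [this, mix]
  by_cases h : j ∈ γ <;> simp [h]

theorem mix_mem_SOL {γ : Finset (Fin n)} {x : Fin n → ℝ} (hx : 0 ≤ x)
    (h : compMatrix A γ *ᵥ x = q) : mix γ x 0 ∈ SOL q A := by
  rw [compMatrix_mulVec] at h
  have h1 : q + A *ᵥ mix γ x 0 = mix γ 0 x := by
    rw [← h]
    abel
  refine ⟨⟨mix_nonneg hx le_rfl, ?_⟩, ?_⟩
  · rw [h1]
    exact mix_nonneg le_rfl hx
  · rw [h1]
    refine Finset.sum_eq_zero fun i _ => ?_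
    by_cases h : i ∈ γ <;> simp [mix, h]

/-- What holds at every state reached by Lemke's algorithm. -/
def LemkeState.Invariant (A : Matrix (Fin n) (Fin n) ℝ) (q d : Fin n → ℝ) :
    LemkeState n → Prop
  | .start => True
  | .pivot b e => ∃ x, (LemkeState.pivot b e).IsAt A q d x
  | .solution z => z ∈ SOL q A ∧ (0 ≤ q ∨ ∃ γ, 0 < (principalSubmatrix A γ).det ∧
      ∃ x, 0 ≤ x ∧ compMatrix A γ *ᵥ x = q)
  | .ray => FEA q A = ∅

theorem LemkeStep.invariant (hE : IsE0 A) (hS : IsStar A) (hd : ∀ i, 0 < d i)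
    {s s' : LemkeState n} (h : LemkeStep A q d s s') (hs : s.Invariant A q d) :
    s'.Invariant A q d := by
  have hstep := h
  cases h with
  | trivial hq => exact ⟨⟨⟨le_rfl, by simpa using hq⟩, by simp⟩, .inl hq⟩
  | init r hq hr =>
    exact ⟨_, isAt_init hd hq hr⟩
  | ray b e hy =>
    obtain ⟨⟨γ, j⟩, hV, b, σ, he, hσ⟩ := hs
    obtain ⟨rfl, rfl⟩ := LemkeState.pivot.inj he
    refine hV.FEA_eq_empty hE hS hd fun i => ?_
    have := hy (σ i)
    rw [← hσ, tableauColumn, inv_basisMatrix_comp_mulVec]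
    exact this
  | solve b e r hb hpos hmin =>
    obtain ⟨⟨γ, j⟩, hV, b, σ, he, hσ⟩ := hs
    obtain ⟨rfl, rfl⟩ := LemkeState.pivot.inj he
    obtain ⟨l, rfl⟩ := σ.surjective r
    have hb' : ∀ i, b (σ i) = acBasis γ j i := fun i => congrFun hσ i
    have hy : ∀ i, tableauColumn A d b (colVar γ j) (σ i) =
        tableauColumn A d (acBasis γ j) (colVar γ j) i := fun i => by
      rw [tableauColumn, tableauColumn, ← hσ, inv_basisMatrix_comp_mulVec]; rfl
    have hv : ∀ i, basicValue A q d b (σ i) = basicValue A q d (acBasis γ j) i := fun i => by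
      rw [basicValue, basicValue, ← hσ, inv_basisMatrix_comp_mulVec]; rfl
    have hl : l = j := by
      by_contra h
      rw [hb', acBasis, Function.update_of_ne h] at hb
      exact colVar_ne_z0 _ _ hb
    subst hl
    simp only [hy] at hpos
    have hsol := hV.solve hpos fun i hi => by
      have := hmin (σ i) (by simpa only [hy] using hi)
      simpa only [hy, hv] using this
    have hx := mulVec_inv_mulVec (det_compMatrix_ne_zero.2 hsol.1.ne') q
    refine ⟨?_, .inr ⟨γ, hsol.1, _, hsol.2, hx⟩⟩
    have hz : basicZ A q d (Function.update b (σ l) (colVar γ l)) =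
        mix γ ((compMatrix A γ)⁻¹ *ᵥ q) 0 := by
      rw [← basicZ_comp _ σ, Function.update_comp_eq_of_injective _ σ.injective, hσ, acBasis,
        Function.update_idem, Function.update_eq_self, basicZ_colVar]
    rw [hz]
    exact mix_mem_SOL hsol.2 hx
  | next b e r hpos hmin hz0 =>
    obtain ⟨x, hx⟩ := hs
    obtain ⟨y, hy, -⟩ := hx.next hstep
    exact ⟨y, hy⟩

theorem invariant_of_reachable (hE : IsE0 A) (hS : IsStar A) (hd : ∀ i, 0 < d i)
    {s : LemkeState n} (h : Relation.ReflTransGen (LemkeStep A q d) .start s) :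
    s.Invariant A q d := by
  induction h with
  | refl => trivial
  | tail _ h ih => exact h.invariant hE hS hd ih

theorem lemkeProcessable (hE : IsE0 A) (hS : IsStar A) (q : Fin n → ℝ) :
    LemkeProcessable q A := by
  intro d hd
  refine ⟨not_exists_infinite_lemke hd, fun s hs hterm => ?_⟩
  have hinv := invariant_of_reachable hE hS hd hs
  cases s with
  | start => exact absurd (exists_lemkeStep_start A q d) hterm
  | pivot b e => exact absurd (exists_lemkeStep_pivot A q d b e) hterm
  | solution z => exact .inl ⟨z, hinv.1, rfl⟩
  | ray => exact .inr ⟨rfl, hinv⟩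

/-- A feasible problem is solved by a complementary cone of positive orientation. -/
theorem exists_pos_cone (hE : IsE0 A) (hS : IsStar A) {z : Fin n → ℝ} (hz : z ∈ FEA q A)
    (hq : ¬ 0 ≤ q) : ∃ γ, 0 < (principalSubmatrix A γ).det ∧
      ∃ x, 0 ≤ x ∧ compMatrix A γ *ᵥ x = q := by
  have hd : ∀ i, 0 < (1 : Fin n → ℝ) i := fun _ => one_pos
  obtain ⟨s, hs, hterm⟩ : ∃ s, Relation.ReflTransGen (LemkeStep A q 1) .start s ∧
      ¬ ∃ s', LemkeStep A q 1 s s' := by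
    by_contra hcon
    push Not at hcon
    choose nxt hnxt using hcon
    let f : ℕ → {s // Relation.ReflTransGen (LemkeStep A q 1) .start s} := fun t =>
      Nat.rec ⟨.start, .refl⟩ (fun _ p => ⟨nxt p.1 p.2, p.2.tail (hnxt p.1 p.2)⟩) t
    exact not_exists_infinite_lemke hd ⟨fun t => (f t).1, rfl, fun t => hnxt (f t).1 (f t).2⟩
  have hinv := invariant_of_reachable hE hS hd hs
  cases s with
  | start => exact absurd (exists_lemkeStep_start A q 1) hterm
  | pivot b e => exact absurd (exists_lemkeStep_pivot A q 1 b e) hterm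
  | solution z => exact hinv.2.resolve_left hq
  | ray =>
    have : FEA q A = ∅ := hinv
    rw [this] at hz
    exact absurd hz (Set.notMem_empty z)

end LemkePath

/-! ### Nonnegativity of the principal minors -/

section NonnegMinors

variable {n : ℕ} {A M : Matrix (Fin n) (Fin n) ℝ} {q : Fin n → ℝ}

/-- On the curve (1, s, s², …) each functional becomes a nonzero polynomial in s, and finitely many
of these have finitely many roots. -/
theorem exists_pos_forall_dotProduct_ne_zero {ι : Type*} [Finite ι] (φ : ι → Fin n → ℝ)
    (h : ∀ k, φ k ≠ 0) : ∃ x : Fin n → ℝ, (∀ i, 0 < x i) ∧ ∀ k, φ k ⬝ᵥ x ≠ 0 := by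
  have := Fintype.ofFinite ι
  let P : ι → Polynomial ℝ := fun k => ∑ i : Fin n, Polynomial.monomial (i : ℕ) (φ k i)
  have hP : ∀ k, P k ≠ 0 := by
    intro k h0
    obtain ⟨i, hi⟩ := Function.ne_iff.1 (h k)
    refine hi ?_
    have h1 := congrArg (fun p => Polynomial.coeff p i) h0
    simpa [P, Polynomial.finsetSum_coeff, Polynomial.coeff_monomial, Fin.val_inj] using h1
  have hprod : ∏ k, P k ≠ 0 := Finset.prod_ne_zero_iff.2 fun k _ => hP k
  obtain ⟨s, hs, hroot⟩ : ∃ s : ℝ, 0 < s ∧ ¬ (∏ k, P k).IsRoot s := by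
    by_contra hcon
    push Not at hcon
    exact hprod (Polynomial.eq_zero_of_infinite_isRoot _
      ((Set.Ioi_infinite (0 : ℝ)).mono fun s hs => hcon s hs))
  refine ⟨fun i => s ^ (i : ℕ), fun i => pow_pos hs _, fun k hk => hroot ?_⟩
  rw [Polynomial.IsRoot, Polynomial.eval_prod]
  refine Finset.prod_eq_zero (Finset.mem_univ k) ?_
  rw [← hk]
  simp [P, Polynomial.eval_finsetSum, dotProduct]

/-- A generic point of the complementary cone `α`: along the line in direction `1`, no basic
solution has two vanishing coordinates. -/
theorem exists_generic_point {α : Finset (Fin n)} (hα : (compMatrix A α).det ≠ 0) :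
    ∃ x : Fin n → ℝ, (∀ i, 0 < x i) ∧ ∀ β, (compMatrix A β).det ≠ 0 → ∀ i j, i ≠ j → ∀ t : ℝ,
      ((compMatrix A β)⁻¹ *ᵥ (compMatrix A α *ᵥ x + t • 1)) i = 0 →
      ((compMatrix A β)⁻¹ *ᵥ (compMatrix A α *ᵥ x + t • 1)) j ≠ 0 := by
  classical
  let g : Finset (Fin n) → Fin n → ℝ := fun β => (compMatrix A β)⁻¹ *ᵥ 1
  -- Coordinates i and j are affine in t with slopes g i and g j. Eliminating t leaves a functional
  -- of x alone that must vanish if both coordinates do; if both slopes are zero, coordinate i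
  -- itself serves.
  let c : Finset (Fin n) × Fin n × Fin n → Fin n → ℝ := fun k =>
    if g k.1 k.2.1 = 0 ∧ g k.1 k.2.2 = 0 then Pi.single k.2.1 1
    else Pi.single k.2.1 (g k.1 k.2.2) - Pi.single k.2.2 (g k.1 k.2.1)
  have hc : ∀ k, k.2.1 ≠ k.2.2 → c k ≠ 0 := by
    rintro ⟨β, i, j⟩ hij h0
    simp only [c] at h0
    split_ifs at h0 with h
    · simpa using congrFun h0 i
    · have h1 := congrFun h0 i
      have h2 := congrFun h0 j
      simp only at hij
      simp [hij, hij.symm] at h1 h2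
      exact h ⟨h2, h1⟩
  obtain ⟨x, hx, hgen⟩ := exists_pos_forall_dotProduct_ne_zero
    (fun k : {k : Finset (Fin n) × Fin n × Fin n //
        (compMatrix A k.1).det ≠ 0 ∧ k.2.1 ≠ k.2.2} =>
      c k.1 ᵥ* ((compMatrix A k.1.1)⁻¹ * compMatrix A α)) (by
    rintro ⟨k, hk, hij⟩ h0
    refine hc k hij (Matrix.eq_zero_of_vecMul_eq_zero ?_ h0)
    rw [Matrix.det_mul, Matrix.det_nonsing_inv, Ring.inverse_eq_inv']
    exact mul_ne_zero (inv_ne_zero hk) hα)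
  refine ⟨x, hx, fun β hβ i j hij t hi hj => hgen ⟨(β, i, j), hβ, hij⟩ ?_⟩
  rw [← Matrix.dotProduct_mulVec, ← Matrix.mulVec_mulVec]
  rw [Matrix.mulVec_add, Matrix.mulVec_smul] at hi hj
  change ((compMatrix A β)⁻¹ *ᵥ (compMatrix A α *ᵥ x)) i + t * g β i = 0 at hi
  change ((compMatrix A β)⁻¹ *ᵥ (compMatrix A α *ᵥ x)) j + t * g β j = 0 at hj
  simp only [c]
  split_ifs with h
  · rw [h.1] at hi
    simpa using hi
  · rw [sub_dotProduct]
    simp only [single_dotProduct]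
    linear_combination g β j * hi - g β i * hj

theorem mem_FEA_ppt {β : Finset (Fin n)} (h : (principalSubmatrix A β).det ≠ 0)
    {z : Fin n → ℝ} (hz : z ∈ FEA q A) :
    mix β (q + A *ᵥ z) z ∈ FEA ((compMatrix A β)⁻¹ *ᵥ q) (ppt A β) := by
  have hC := det_compMatrix_ne_zero.2 h
  refine ⟨mix_nonneg hz.2 hz.1, ?_⟩
  have h1 := compMatrix_mulVec_add_compl (A := A) β (mix β z (q + A *ᵥ z))
    (mix β (q + A *ᵥ z) z)
  have e1 : mix β (mix β (q + A *ᵥ z) z) (mix β z (q + A *ᵥ z)) = q + A *ᵥ z := by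
    ext i; by_cases hi : i ∈ β <;> simp [mix, hi]
  have e2 : mix β (mix β z (q + A *ᵥ z)) (mix β (q + A *ᵥ z) z) = z := by
    ext i; by_cases hi : i ∈ β <;> simp [mix, hi]
  rw [e1, e2, add_sub_cancel_right] at h1
  have h2 : (compMatrix A β)⁻¹ *ᵥ q + ppt A β *ᵥ mix β (q + A *ᵥ z) z =
      mix β z (q + A *ᵥ z) := by
    refine (inv_mulVec_eq hC rfl).symm.trans (inv_mulVec_eq hC ?_)
    rw [Matrix.mulVec_add, mulVec_inv_mulVec hC, Matrix.mulVec_mulVec, compMatrix_mul_ppt h,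
      Matrix.neg_mulVec, ← sub_eq_add_neg]
    exact eq_sub_of_add_eq h1
  rw [h2]
  exact mix_nonneg hz.1 hz.2

/-- A nonzero z-part would have an index with zᵢ > 0, hence wᵢ = 0, and (Az)ᵢ ≥ 0, against qᵢ > 0.
-/
theorem eq_empty_of_pos (hE : IsE0 A) (hq : ∀ i, 0 < q i) {β : Finset (Fin n)}
    {x : Fin n → ℝ} (hx : 0 ≤ x) (h : compMatrix A β *ᵥ x = q) : β = ∅ := by
  rw [compMatrix_mulVec] at h
  by_cases hz : mix β x 0 = 0
  · refine Finset.eq_empty_of_forall_notMem fun i hi => ?_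
    have h1 := congrFun h i
    have h2 := hq i
    rw [hz, Matrix.mulVec_zero] at h1
    simp [mix, hi] at h1
    linarith
  · obtain ⟨i, hi, hAi⟩ := hE _ (mix_nonneg hx le_rfl) hz
    have hiβ : i ∈ β := by
      by_contra h
      simp [mix, h] at hi
    have h1 := congrFun h i
    have h2 := hq i
    rw [Pi.sub_apply] at h1
    have h3 : mix β 0 x i = 0 := by simp [mix, hiβ]
    linarith

theorem mix_singleton (i : Fin n) (x : Fin n → ℝ) : mix {i} x 0 = Pi.single i (x i) := by
  ext l
  by_cases h : l = i
  · subst h; simp [mix]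
  · simp [mix, h]

theorem mix_pair {i j : Fin n} (hij : i ≠ j) (x : Fin n → ℝ) :
    mix {i, j} x 0 = Pi.single i (x i) + Pi.single j (x j) := by
  ext l
  by_cases h : l = i
  · subst h; simp [mix, hij]
  · by_cases h' : l = j
    · subst h'; simp [mix, h]
    · simp [mix, h, h']

theorem det_principalSubmatrix_singleton (M : Matrix (Fin n) (Fin n) ℝ) (i : Fin n) :
    (principalSubmatrix M {i}).det = M i i := by
  have : Unique {x // x ∈ ({i} : Finset (Fin n))} :=
    ⟨⟨⟨i, Finset.mem_singleton_self i⟩⟩, fun x => Subtype.ext (Finset.mem_singleton.1 x.2)⟩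
  rw [Matrix.det_eq_elem_of_subsingleton _ ⟨i, Finset.mem_singleton_self i⟩]
  rfl

theorem bijective_pair {i j : Fin n} (hij : i ≠ j) : Function.Bijective
    (![⟨i, by simp⟩, ⟨j, by simp⟩] : Fin 2 → {x // x ∈ ({i, j} : Finset (Fin n))}) := by
  constructor
  · intro a b h
    fin_cases a <;> fin_cases b <;> simp_all [hij.symm]
  · rintro ⟨x, hx⟩
    rcases Finset.mem_insert.1 hx with rfl | h
    · exact ⟨0, rfl⟩
    · exact ⟨1, Subtype.ext (Finset.mem_singleton.1 h).symm⟩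

theorem det_principalSubmatrix_pair (M : Matrix (Fin n) (Fin n) ℝ) {i j : Fin n} (hij : i ≠ j) :
    (principalSubmatrix M {i, j}).det = M i i * M j j - M i j * M j i := by
  rw [← Matrix.det_submatrix_equiv_self (Equiv.ofBijective _ (bijective_pair hij)),
    Matrix.det_fin_two]
  rfl

theorem IsExactOrderC0.diag_nonneg {k : ℕ} (hn : k + 1 ≤ n) (h : IsExactOrderC0 k M)
    (i : Fin n) : 0 ≤ M i i := by
  have h1 := h {i} (by simp; omega) 1 zero_le_one
  simp only [dotProduct, Matrix.mulVec,
    Fintype.sum_subsingleton _ (⟨i, Finset.mem_singleton_self i⟩ : {x // x ∈ ({i} : Finset (Fin n))})]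
    at h1
  simpa [principalSubmatrix, Matrix.toBlock] using h1

theorem IsExactOrderC0.add_nonneg {k : ℕ} (hn : k + 2 ≤ n) (h : IsExactOrderC0 k M)
    {i j : Fin n} (hij : i ≠ j) (hi : M i i = 0) : 0 ≤ M i j + M j i := by
  have hcop := h {i, j} (by rw [Finset.card_pair hij]; omega)
  -- The quadratic form at (t, 1). It is affine in t because M i i = 0, so its slope cannot be
  -- negative.
  have key : ∀ t : ℝ, 0 ≤ t → 0 ≤ t * (M i j + M j i) + M j j := by
    intro t ht
    let e := Equiv.ofBijective _ (bijective_pair hij)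
    have h1 := hcop ((![t, 1] : Fin 2 → ℝ) ∘ e.symm) (by
      intro x
      obtain ⟨a, rfl⟩ := e.surjective x
      fin_cases a <;> simp [ht])
    simp only [dotProduct, Matrix.mulVec] at h1
    simp only [← e.sum_comp, Function.comp_apply, Equiv.symm_apply_apply, Fin.sum_univ_two] at h1
    change 0 ≤ t * (M i i * t + M i j * 1) + 1 * (M j i * t + M j j * 1) at h1
    rw [hi] at h1
    linarith
  by_contra hneg
  have hneg := not_le.1 hneg
  have h0 := key 0 le_rfl
  have h1 := key ((M j j + 1) / -(M i j + M j i)) (div_nonneg (by linarith) (by linarith))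
  rw [div_mul_eq_mul_div, div_neg, mul_div_assoc, div_self hneg.ne] at h1
  linarith

/-- If column i were nonnegative, the unit vector eᵢ would be a homogeneous solution. Its star
vector is a positive multiple of eᵢ, which forces row i to be nonpositive. -/
theorem IsStar.exists_neg (hS : IsStar M) {i : Fin n} (hii : M i i = 0)
    (hrow : ¬ ∀ l, M i l ≤ 0) : ∃ j, M j i < 0 := by
  by_contra hcon
  push Not at hcon
  refine hrow fun l => ?_
  have hcol : M *ᵥ Pi.single i 1 = fun l => M l i := by
    rw [Matrix.mulVec_single_one]; rfl
  have hsol : Pi.single i 1 ∈ SOL 0 M := by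
    refine ⟨⟨by simp, ?_⟩, ?_⟩
    · rw [hcol, zero_add]
      exact hcon
    · rw [hcol, zero_add]
      simp [hii]
  obtain ⟨s, hs, hs0, hMs, hsupp, -⟩ := hS _ hsol (by simp)
  have hsi : s = Pi.single i (s i) := by
    ext l
    by_cases h : l = i
    · subst h; simp
    · have : s l = 0 := by
        by_contra h2
        exact hsupp l h2 (by simp [h])
      simp [h, this]
  have hpos : 0 < s i := by
    refine lt_of_le_of_ne (hs i) fun h => hs0 ?_
    rw [hsi, ← h, Pi.single_zero]
  have h1 := hMs l
  rw [hsi, Matrix.mulVec_single] at h1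
  simp at h1
  by_contra h2
  have := mul_pos (not_le.1 h2) hpos
  linarith

/-- Crossing the facet `i` of the nonnegative orthant into a cone of positive orientation. -/
theorem exists_adjacent_cone (hS : IsStar M) (hdiag : ∀ i, 0 ≤ M i i)
    (hpair : ∀ i j, i ≠ j → M i i = 0 → 0 ≤ M i j + M j i) {p : Fin n → ℝ} {i : Fin n}
    (hpi : p i = 0) (hp : ∀ j, j ≠ i → 0 < p j) (hrow : ¬ ∀ l, M i l ≤ 0) :
    ∃ (γ : Finset (Fin n)) (c : Fin n) (m : ℝ) (y : Fin n → ℝ), 0 < m ∧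
      0 < (principalSubmatrix M γ).det ∧ 0 ≤ y ∧ compMatrix M γ *ᵥ y = p ∧
      ∀ x, m * x c = -(compMatrix M γ *ᵥ x) i := by
  rcases (hdiag i).lt_or_eq with hii | hii
  · refine ⟨{i}, i, M i i, p, hii, by rwa [det_principalSubmatrix_singleton], ?_, ?_, ?_⟩
    · intro j
      by_cases h : j = i
      · rw [h, hpi]; rfl
      · exact (hp j h).le
    · rw [compMatrix_mulVec, mix_singleton, hpi]
      ext l
      by_cases h : l = i
      · subst h; simp [mix, hpi]
      · simp [mix, h]
    · intro x
      rw [compMatrix_mulVec, mix_singleton, Matrix.mulVec_single]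
      simp [mix, mul_comm]
  · have hii := hii.symm
    obtain ⟨j₀, hj₀⟩ := hS.exists_neg hii hrow
    -- With zero diagonal entry a single exchange is singular. Raise zᵢ until w_j is the first to
    -- reach zero, at zᵢ = θ, and exchange j too; the minor of {i, j} is -M i j * M j i > 0.
    obtain ⟨j, hj, hmin⟩ := Finset.exists_min_image
      (Finset.univ.filter fun j => M j i < 0) (fun j => p j / -M j i) ⟨j₀, by simpa using hj₀⟩
    simp only [Finset.mem_filter, Finset.mem_univ, true_and] at hj hmin
    have hji : j ≠ i := by
      rintro rfl
      linarith
    set θ := p j / -M j i with hθ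
    have hθ0 : 0 < θ := div_pos (hp j hji) (neg_pos.2 hj)
    have hθj : θ * M j i = -p j := by
      rw [hθ, div_neg, neg_mul, div_mul_cancel₀ _ hj.ne]
    have hij : 0 < M i j := by
      have := hpair i j hji.symm hii
      linarith
    refine ⟨{i, j}, j, M i j, fun l => if l = i then θ else if l = j then 0 else p l + θ * M l i,
      hij, ?_, ?_, ?_, ?_⟩
    · rw [det_principalSubmatrix_pair M hji.symm, hii]
      have := mul_pos hij (neg_pos.2 hj)
      linarith
    · intro l
      simp only [Pi.zero_apply]
      split_ifs with h h'
      · exact hθ0.le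
      · exact le_rfl
      · rcases le_or_gt 0 (M l i) with hl | hl
        · exact add_nonneg (hp l h).le (mul_nonneg hθ0.le hl)
        · have h1 := hmin l hl
          rw [le_div_iff₀ (neg_pos.2 hl)] at h1
          linarith
    · rw [compMatrix_mulVec, mix_pair hji.symm, Matrix.mulVec_add, Matrix.mulVec_single,
        Matrix.mulVec_single]
      ext l
      by_cases h : l = i
      · subst h; simp [mix, hji, hii, hpi]
      · by_cases h' : l = j
        · subst h'
          simp [mix, hji]
          linarith
        · simp [mix, h, h', hji]
    · intro x
      rw [compMatrix_mulVec, mix_pair hji.symm, Matrix.mulVec_add, Matrix.mulVec_single,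
        Matrix.mulVec_single]
      simp [mix, hii, mul_comm]

/-- A matrix with the star property is `P₀` if each of its principal pivot transforms is `E₀`
or satisfies the order-two consequences of copositivity. -/
theorem isP0_of_ppt (hE : IsE0 A) (hS : IsStar A)
    (hM : ∀ M, IsPPT A M → IsE0 M ∨ ((∀ i, 0 ≤ M i i) ∧
      ∀ i j, i ≠ j → M i i = 0 → 0 ≤ M i j + M j i)) : IsP0 A := by
  intro α
  by_contra hα
  have hα := not_le.1 hα
  obtain ⟨x, hx, hgen⟩ := exists_generic_point (det_compMatrix_ne_zero.2 hα.ne)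
  set q := compMatrix A α *ᵥ x with hq
  have hxn : 0 ≤ x := fun i => (hx i).le
  have hfea : ∀ t : ℝ, 0 ≤ t → mix α x 0 ∈ FEA (q + t • 1) A := by
    intro t ht
    have h1 := (mix_mem_SOL hxn hq.symm).1
    refine ⟨h1.1, ?_⟩
    rw [add_right_comm]
    refine add_nonneg h1.2 fun i => ?_
    simpa using ht
  -- The parameters at which the moving point lies in a negatively oriented cone.
  let T : Set ℝ := {t | 0 ≤ t ∧ ∃ β, (principalSubmatrix A β).det < 0 ∧
    0 ≤ (compMatrix A β)⁻¹ *ᵥ (q + t • 1)}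
  have hcont : ∀ β, Continuous fun t : ℝ => (compMatrix A β)⁻¹ *ᵥ (q + t • (1 : Fin n → ℝ)) :=
    fun β => by fun_prop
  have hTne : T.Nonempty := by
    refine ⟨0, le_rfl, α, hα, ?_⟩
    rw [zero_smul, add_zero, inv_mulVec_eq (det_compMatrix_ne_zero.2 hα.ne) rfl]
    exact hxn
  have hTcl : IsClosed T := by
    have : T = Set.Ici 0 ∩ ⋃ β ∈ {β : Finset (Fin n) | (principalSubmatrix A β).det < 0},
        {t : ℝ | 0 ≤ (compMatrix A β)⁻¹ *ᵥ (q + t • (1 : Fin n → ℝ))} := by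
      ext t
      simp [T]
    rw [this]
    exact isClosed_Ici.inter ((Set.toFinite _).isClosed_biUnion fun β _ =>
      isClosed_le continuous_const (hcont β))
  have hTbd : BddAbove T := by
    -- Beyond this bound every coordinate of q + t·1 is positive, so only the cone ∅, with
    -- determinant 1, remains.
    refine ⟨∑ i, |q i|, fun t ht => ?_⟩
    obtain ⟨-, β, hβ, hβx⟩ := ht
    by_contra hlt
    have hlt := not_le.1 hlt
    have hpos : ∀ i, 0 < (q + t • (1 : Fin n → ℝ)) i := by
      intro i
      have h1 := Finset.single_le_sum (f := fun i => |q i|) (fun i _ => abs_nonneg _)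
        (Finset.mem_univ i)
      have h2 := neg_abs_le (q i)
      simp only [Pi.add_apply, Pi.smul_apply, Pi.one_apply, smul_eq_mul, mul_one]
      linarith
    have := eq_empty_of_pos hE hpos hβx
      (mulVec_inv_mulVec (det_compMatrix_ne_zero.2 hβ.ne) _)
    subst this
    rw [det_principalSubmatrix, compMatrix_empty] at hβ
    norm_num at hβ
  have hmem := hTcl.csSup_mem hTne hTbd
  have hmax : ∀ t ∈ T, t ≤ sSup T := fun t ht => le_csSup hTbd ht
  set τ := sSup T
  obtain ⟨hτ, β, hβ, hβx⟩ := hmem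
  have hC := det_compMatrix_ne_zero.2 hβ.ne
  have hSM := hS.ppt hβ.ne
  -- a positively oriented cone of the transform would give a larger parameter
  have hpush : ∀ γ t, τ < t → 0 < (principalSubmatrix (ppt A β) γ).det → ∀ y, 0 ≤ y →
      compMatrix (ppt A β) γ *ᵥ y = (compMatrix A β)⁻¹ *ᵥ (q + t • 1) → False := by
    intro γ t ht hγ y hy hyq
    have hdet := det_principalSubmatrix_symmDiff hβ.ne γ
    have hneg : (principalSubmatrix A (symmDiff β γ)).det < 0 := by
      rw [hdet]
      exact mul_neg_of_neg_of_pos hβ hγ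
    refine absurd (hmax t ⟨hτ.trans ht.le, symmDiff β γ, hneg, ?_⟩) (not_le.2 ht)
    rw [inv_mulVec_eq (x := y) (det_compMatrix_ne_zero.2 hneg.ne)]
    · exact hy
    · rw [← compMatrix_mul_compMatrix_ppt hβ.ne, ← Matrix.mulVec_mulVec, hyq,
        mulVec_inv_mulVec hC]
  have hstay : ∀ t, τ < t → ¬ 0 ≤ (compMatrix A β)⁻¹ *ᵥ (q + t • 1) := fun t ht h =>
    absurd (hmax t ⟨hτ.trans ht.le, β, hβ, h⟩) (not_le.2 ht)
  rcases hM _ ⟨β, hβ.ne, rfl⟩ with hE0 | ⟨hdiag, hpair⟩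
  · have ht : τ < τ + 1 := lt_add_one τ
    obtain ⟨γ, hγ, y, hy, hyq⟩ := exists_pos_cone hE0 hSM
      (mem_FEA_ppt hβ.ne (hfea (τ + 1) (hτ.trans ht.le))) (hstay _ ht)
    exact hpush γ _ ht hγ y hy hyq
  · -- a coordinate that becomes negative
    obtain ⟨i, hi0, hineg⟩ : ∃ i, ((compMatrix A β)⁻¹ *ᵥ (q + τ • 1)) i = 0 ∧
        ∀ t, τ < t → ((compMatrix A β)⁻¹ *ᵥ (q + t • 1)) i < 0 := by
      by_contra hcon
      push Not at hcon
      have hev : ∀ i, ∀ᶠ t in nhdsWithin τ (Set.Ioi τ),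
          0 ≤ ((compMatrix A β)⁻¹ *ᵥ (q + t • 1)) i := by
        intro i
        rcases (hβx i).lt_or_eq with h | h
        · have := ((continuous_apply i).comp (hcont β)).tendsto τ
          exact (this.eventually_const_lt h).filter_mono nhdsWithin_le_nhds |>.mono
            fun t ht => ht.le
        · obtain ⟨t₁, ht₁, h1⟩ := hcon i h.symm
          filter_upwards [self_mem_nhdsWithin] with t ht
          have ht : τ < t := ht
          simp only [Matrix.mulVec_add, Matrix.mulVec_smul, Pi.add_apply, Pi.smul_apply,
            Pi.zero_apply, smul_eq_mul] at h h1 ⊢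
          set a := ((compMatrix A β)⁻¹ *ᵥ q) i
          set b := ((compMatrix A β)⁻¹ *ᵥ (1 : Fin n → ℝ)) i
          have hb : 0 ≤ b := by
            by_contra hb
            nlinarith
          nlinarith
      obtain ⟨t, ht, h⟩ := ((Filter.eventually_all.2 hev).and self_mem_nhdsWithin).exists
      exact hstay t h ht
    have hp : ∀ j, j ≠ i → 0 < ((compMatrix A β)⁻¹ *ᵥ (q + τ • 1)) j := fun j hj =>
      lt_of_le_of_ne (hβx j) (Ne.symm (hgen β hC i j hj.symm τ hi0))
    -- A nonpositive row i would contradict feasibility of the transformed problem at τ + 1, where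
    -- coordinate i of its right-hand side is negative.
    have hrow : ¬ ∀ l, ppt A β i l ≤ 0 := by
      intro hrow
      have h1 := mem_FEA_ppt hβ.ne (hfea (τ + 1) (by linarith))
      have h2 := h1.2 i
      have h3 := hineg (τ + 1) (lt_add_one τ)
      have h4 : (ppt A β *ᵥ mix β (q + (τ + 1) • 1 + A *ᵥ mix α x 0) (mix α x 0)) i ≤ 0 :=
        Finset.sum_nonpos (s := Finset.univ) fun l _ =>
          mul_nonpos_of_nonpos_of_nonneg (hrow l) (h1.1 l)
      simp only [Pi.add_apply, Pi.zero_apply] at h2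
      linarith
    obtain ⟨γ, c, m, y, hm, hγ, hy, hyp, hc⟩ :=
      exists_adjacent_cone hSM hdiag hpair hi0 hp hrow
    have hneg : (principalSubmatrix A (symmDiff β γ)).det < 0 := by
      rw [det_principalSubmatrix_symmDiff hβ.ne]
      exact mul_neg_of_neg_of_pos hβ hγ
    have hC' := det_compMatrix_ne_zero.2 hneg.ne
    have hsol : ∀ t : ℝ, compMatrix (ppt A β) γ *ᵥ
        ((compMatrix A (symmDiff β γ))⁻¹ *ᵥ (q + t • 1)) =
        (compMatrix A β)⁻¹ *ᵥ (q + t • 1) := by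
      intro t
      refine (inv_mulVec_eq hC ?_).symm
      rw [Matrix.mulVec_mulVec, compMatrix_mul_compMatrix_ppt hβ.ne, mulVec_inv_mulVec hC']
    have hyτ : (compMatrix A (symmDiff β γ))⁻¹ *ᵥ (q + τ • 1) = y := by
      refine inv_mulVec_eq hC' ?_
      rw [← compMatrix_mul_compMatrix_ppt hβ.ne, ← Matrix.mulVec_mulVec, hyp,
        mulVec_inv_mulVec hC]
    have hc0 : y c = 0 := by
      have := hc y
      rw [hyp, hi0, neg_zero] at this
      exact (mul_eq_zero.1 this).resolve_left hm.ne'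
    -- Past τ, coordinate c is nonnegative because it is -1/m times the coordinate that turns
    -- negative. The others are positive at τ by genericity, hence also shortly afterwards.
    have hev : ∀ l, ∀ᶠ t in nhdsWithin τ (Set.Ioi τ),
        0 ≤ ((compMatrix A (symmDiff β γ))⁻¹ *ᵥ (q + t • 1)) l := by
      intro l
      by_cases hl : l = c
      · subst hl
        filter_upwards [self_mem_nhdsWithin] with t ht
        have h1 := hc ((compMatrix A (symmDiff β γ))⁻¹ *ᵥ (q + t • 1))
        rw [hsol] at h1
        have h2 := hineg t ht
        by_contra h3
        have := mul_pos hm (neg_pos.2 (not_le.1 h3))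
        linarith
      · have hyl : 0 < y l := by
          refine lt_of_le_of_ne (hy l) fun h => ?_
          refine hgen _ hC' c l (Ne.symm hl) τ ?_ ?_ <;> rw [hyτ]
          exacts [hc0, h.symm]
        rw [← hyτ] at hyl
        have := ((continuous_apply l).comp (hcont (symmDiff β γ))).tendsto τ
        exact (this.eventually_const_lt hyl).filter_mono nhdsWithin_le_nhds |>.mono
          fun t ht => ht.le
    obtain ⟨t, ht, h⟩ := ((Filter.eventually_all.2 hev).and self_mem_nhdsWithin).exists
    exact hpush γ t h hγ _ ht (hsol t)

end NonnegMinors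

end LCP

theorem mainTheorem3 (n k : ℕ) (hn : k + 2 ≤ n) (A : Matrix (Fin n) (Fin n) ℝ)
    (hA : LCP.IsE0sTilde A) (hC : LCP.IsExactOrderC0f k A)
    (hM : ∀ M, LCP.IsPPT A M →
      LCP.IsExactOrderC0 k M ∨ (LCP.IsE0 M ∧ k ≤ LCP.numPosDiag M)) :
    LCP.IsP0 A ∧ ∀ q : Fin n → ℝ, LCP.LemkeProcessable q A := by
  refine ⟨LCP.isP0_of_ppt hA.1.1 hA.isStar fun M hMA => ?_,
    LCP.lemkeProcessable hA.1.1 hA.isStar⟩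
  rcases hM M hMA with h | h
  -- Principal submatrices of orders 1 and 2 fall within the range n - k; their copositivity is all
  -- that is needed.
  · exact .inr ⟨h.diag_nonneg (by omega), fun i j hij => h.add_nonneg hn hij⟩
  · exact .inl h.1
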